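/- **Setting.** A linear representation $(\xi,A,B,\eta)$ of size $m$ consists of vectors $\xi,\eta\in\mathbb R_+^m$ and matrices $A,B\in\mathbb R_+^{m\times m}$, with nonnegative real entries. Let $\mu:\{a,b\}^*\to\mathbb R_+^{m\times m}$ be the monoid morphism with $\mu(a)=A$, $\mu(b)=B$, and let $(r,w)=\xi'\mu(w)\eta$ for each word $w$. It is assumed that $A\neq 0\neq B$ and that for every $n\ge 1$ some $w\in\{a,b\}^n$ has $(r,w)>0$. Then $Y_n$ is the number $|w|_a$ of occurrences of $a$ in a word $w$ drawn from $\{a,b\}^n$ with probability $\Pr(w)=(r,w)/\sum_{x\in\{a,b\}^n}(r,x)$. The transition graph of $(A,B)$ has vertices $1,\dots,m$ and an edge $i\to j$ labelled $a$ (resp. $b$) whenever $A_{ij}>0$ (resp. $B_{ij}>0$). The pair $(A,B)$ is *aperiodic* if the greatest common divisor of all differences $|\ell(\mathcal C_1)|_a-|\ell(\mathcal C_2)|_a$ is $1$, where $\mathcal C_1,\mathcal C_2$ range over the cycles (closed walks) of equal length in this graph and $\ell(\mathcal C)$ is the word labelling $\mathcal C$. Suppose $M=A+B$ is primitive, with Perron–Frobenius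 eigenvalue $\lambda$ and strictly positive left and right eigenvectors $\zeta,\nu$ for $\lambda$ normalized by $\zeta'\nu=1$. Let $u(z)$ be the function, analytic near $z=0$, defined implicitly by $\det(Iu-Ae^z-B)=0$ and $u(0)=\lambda$, and put $$\alpha=\xi'\nu\,\zeta'\eta,\qquad \beta=\frac{u'(0)}{\lambda},\qquad \gamma=\frac{u''(0)}{\lambda}-\Big(\frac{u'(0)}{\lambda}\Big)^2 .$$ **Theorem.** Let $(\xi_1,A_1,B_1,\eta_1)$ and $(\xi_2,A_2,B_2,\eta_2)$ be linear representations with $\xi_j\ne0\ne\eta_j$ and with $M_j=A_j+B_j$ primitive ($j=1,2$), having the same Perron–Frobenius eigenvalue $\lambda_1=\lambda_2$, and such that both pairs $(A_1,B_1)$, $(A_2,B_2)$ are aperiodic. Let $\{Y_n\}$ be defined by the equipotent sum model $$\xi=\begin{pmatrix}\xi_1\\ \xi_2\end{pmatrix},\quad A=\begin{pmatrix}A_1&0\\0&A_2\end{pmatrix},\quad B=\begin{pmatrix}B_1&0\\0&B_2\end{pmatrix},\quad \eta=\begin{pmatrix}\eta_1\\ \eta_2\end{pmatrix},$$ where $(\xi,A,B,\eta)$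 satisfies the assumptions above, and let $\alpha_j,\beta_j,\gamma_j$ be the constants $\alpha,\beta,\gamma$ of the $j$-th representation. Then $\alpha_j>0$ and $\gamma_j>0$ for $j=1,2$, and, as $n\to+\infty$, $$\left|\sqrt n\,\Pr(Y_n=k)-\left(\frac{\alpha_1}{\alpha_1+\alpha_2}\frac{e^{-\frac{(k-\beta_1n)^2}{2\gamma_1n}}}{\sqrt{2\pi\gamma_1}}+\frac{\alpha_2}{\alpha_1+\alpha_2}\frac{e^{-\frac{(k-\beta_2n)^2}{2\gamma_2n}}}{\sqrt{2\pi\gamma_2}}\right)\right|=O(n^{-1/2})$$ uniformly for every $k\in\{0,1,\dots,n\}$. -/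

import Mathlib

open scoped Matrix

/-- The binary alphabet `{a, b}`. -/
inductive Letter : Type
  | a : Letter
  | b : Letter
  deriving DecidableEq

instance : Fintype Letter :=
  ⟨{Letter.a, Letter.b}, fun l => by cases l <;> simp⟩

/-- A linear representation `(ξ, A, B, η)` with nonnegative real entries, indexed by the
finite set `ι` of states. -/
structure LinearRepresentation (ι : Type*) where
  ξ : ι → ℝ
  A : Matrix ι ι ℝ
  B : Matrix ι ι ℝ
  η : ι → ℝ
  ξ_nonneg : ∀ i, 0 ≤ ξ i
  A_nonneg : ∀ i j, 0 ≤ A i j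
  B_nonneg : ∀ i j, 0 ≤ B i j
  η_nonneg : ∀ i, 0 ≤ η i

namespace LinearRepresentation

noncomputable section

variable {ι : Type*}

/-- The matrix of a single letter: `μ(a) = A`, `μ(b) = B`. -/
def letterMatrix (R : LinearRepresentation ι) : Letter → Matrix ι ι ℝ
  | Letter.a => R.A
  | Letter.b => R.B

/-- `M = A + B`. -/
def M (R : LinearRepresentation ι) : Matrix ι ι ℝ := R.A + R.B

/-- `R.IsWalk i w j`: in the transition graph there is a walk from `i` to `j` with label `w`.
There is an edge from `i` to `j` labelled `l` exactly when the corresponding entry of the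
matrix of `l` is positive. -/
inductive IsWalk (R : LinearRepresentation ι) : ι → List Letter → ι → Prop
  | nil (i : ι) : IsWalk R i [] i
  | cons {i j k : ι} {l : Letter} {w : List Letter} :
      0 < R.letterMatrix l i j → IsWalk R j w k → IsWalk R i (l :: w) k

/-- `w` is the label of a cycle (closed walk) of the transition graph. -/
def IsCycleLabel (R : LinearRepresentation ι) (w : List Letter) : Prop :=
  ∃ i, R.IsWalk i w i

/-- The GCD of all differences in the number of occurrences of `a` in labels of cycles of
equal length (with value `0` if all the differences vanish). -/
def period (R : LinearRepresentation ι) : ℕ :=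
  Nat.setGcd {d : ℕ | ∃ w₁ w₂ : List Letter, R.IsCycleLabel w₁ ∧ R.IsCycleLabel w₂ ∧
    w₁.length = w₂.length ∧
    d = ((w₁.count Letter.a : ℤ) - (w₂.count Letter.a : ℤ)).natAbs}

/-- The pair `(A, B)` is aperiodic. -/
def IsAperiodicPair (R : LinearRepresentation ι) : Prop := R.period = 1

variable [Fintype ι] [DecidableEq ι]

/-- The monoid morphism `μ : {a,b}* → ℝ₊^{m×m}` generated by `A` and `B`. -/
def μ (R : LinearRepresentation ι) (w : List Letter) : Matrix ι ι ℝ :=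
  (w.map R.letterMatrix).prod

/-- The formal series `(r, w) = ξ' μ(w) η`. -/
def series (R : LinearRepresentation ι) (w : List Letter) : ℝ :=
  R.ξ ⬝ᵥ (R.μ w *ᵥ R.η)

/-- Words of length `n` are functions `Fin n → Letter`; this is the probability
`Pr(w) = (r, w) / ∑_{|x| = n} (r, x)`. -/
def wordProb (R : LinearRepresentation ι) (n : ℕ) (w : Fin n → Letter) : ℝ :=
  R.series (List.ofFn w) / ∑ x : Fin n → Letter, R.series (List.ofFn x)

/-- `Pr(Y_n = k)`, where `Y_n = |w|_a` for a random word `w` of length `n`. -/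
def probY (R : LinearRepresentation ι) (n k : ℕ) : ℝ :=
  ∑ w : Fin n → Letter with (List.ofFn w).count Letter.a = k, R.wordProb n w

/-- Standing assumptions: in each positive length there is a word of positive weight, so that
`Pr` is a probability, and `A` and `B` are not null. -/
structure IsAdmissible (R : LinearRepresentation ι) : Prop where
  exists_pos : ∀ n : ℕ, 0 < n → ∃ w : Fin n → Letter, 0 < R.series (List.ofFn w)
  A_ne_zero : R.A ≠ 0
  B_ne_zero : R.B ≠ 0

/-- The Perron-Frobenius eigenvalue of the nonnegative matrix `M = A + B`, that is, its
spectral radius. -/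
def perronRoot (R : LinearRepresentation ι) : ℝ :=
  (spectralRadius ℂ (R.M.map ((↑) : ℝ → ℂ))).toReal

/-- `(ζ, ν)` is a pair of strictly positive left and right eigenvectors of `M` for the
Perron-Frobenius eigenvalue, normalized by `ζ'ν = 1`. -/
structure IsPerronPair (R : LinearRepresentation ι) (p : (ι → ℝ) × (ι → ℝ)) : Prop where
  left_pos : ∀ i, 0 < p.1 i
  right_pos : ∀ i, 0 < p.2 i
  left_eigen : p.1 ᵥ* R.M = R.perronRoot • p.1
  right_eigen : R.M *ᵥ p.2 = R.perronRoot • p.2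
  normalized : p.1 ⬝ᵥ p.2 = 1

/-- The normalized Perron eigenvectors `(ζ, ν)` (unique up to replacing `(ζ, ν)` by
`(c⁻¹ζ, cν)` with `c > 0`). -/
def perronPair (R : LinearRepresentation ι) : (ι → ℝ) × (ι → ℝ) :=
  Classical.epsilon R.IsPerronPair

/-- The left Perron eigenvector. -/
def ζ (R : LinearRepresentation ι) : ι → ℝ := R.perronPair.1

/-- The right Perron eigenvector. -/
def ν (R : LinearRepresentation ι) : ι → ℝ := R.perronPair.2

/-- `u` is analytic at `0`, with `Det(I u(z) - A e^z - B) = 0` near `0` and `u(0)` the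
Perron-Frobenius eigenvalue. -/
structure IsMainBranch (R : LinearRepresentation ι) (u : ℂ → ℂ) : Prop where
  analyticAt : AnalyticAt ℂ u 0
  apply_zero : u 0 = (R.perronRoot : ℂ)
  det_eq_zero : ∀ᶠ z in nhds (0 : ℂ),
    (u z • (1 : Matrix ι ι ℂ) - Complex.exp z • R.A.map ((↑) : ℝ → ℂ)
      - R.B.map ((↑) : ℝ → ℂ)).det = 0

/-- The function `u(z)` implicitly defined by `Det(I u - A e^z - B) = 0` and `u(0) = λ`
(unique as a germ at `0` when `M` is primitive, since `λ` is then a simple eigenvalue). -/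
def u (R : LinearRepresentation ι) : ℂ → ℂ := Classical.epsilon R.IsMainBranch

/-- `α = ξ'ν ζ'η`. -/
def α (R : LinearRepresentation ι) : ℝ := (R.ξ ⬝ᵥ R.ν) * (R.ζ ⬝ᵥ R.η)

/-- `β = u'(0) / λ`. Since `A`, `B`, `λ` are real, `z ↦ conj (u (conj z))` solves the same
equation, so the derivatives of `u` at `0` are real; the real part only changes the type. -/
def β (R : LinearRepresentation ι) : ℝ := (deriv R.u 0).re / R.perronRoot

/-- `γ = u''(0) / λ - (u'(0) / λ)²`; see `β` for the real part. -/
def γ (R : LinearRepresentation ι) : ℝ :=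
  (iteratedDeriv 2 R.u 0).re / R.perronRoot - ((deriv R.u 0).re / R.perronRoot) ^ 2

end

variable {ι₁ ι₂ : Type*}

/-- The linear representation with block diagonal matrices and no communication between the
components `R₁` and `R₂`. -/
def directSum (R₁ : LinearRepresentation ι₁) (R₂ : LinearRepresentation ι₂) :
    LinearRepresentation (ι₁ ⊕ ι₂) where
  ξ := Sum.elim R₁.ξ R₂.ξ
  A := Matrix.fromBlocks R₁.A 0 0 R₂.A
  B := Matrix.fromBlocks R₁.B 0 0 R₂.B
  η := Sum.elim R₁.η R₂.η
  ξ_nonneg := by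
    rintro (i | i)
    · exact R₁.ξ_nonneg i
    · exact R₂.ξ_nonneg i
  A_nonneg := by
    rintro (i | i) (j | j)
    · exact R₁.A_nonneg i j
    · exact le_refl _
    · exact le_refl _
    · exact R₂.A_nonneg i j
  B_nonneg := by
    rintro (i | i) (j | j)
    · exact R₁.B_nonneg i j
    · exact le_refl _
    · exact le_refl _
    · exact R₂.B_nonneg i j
  η_nonneg := by
    rintro (i | i)
    · exact R₁.η_nonneg i
    · exact R₂.η_nonneg i

variable [Fintype ι₁] [DecidableEq ι₁] [Fintype ι₂] [DecidableEq ι₂]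

/-- `R₁` and `R₂` are the components of a sum model, whose linear representation is
`R₁.directSum R₂`. -/
structure IsSumModel (R₁ : LinearRepresentation ι₁) (R₂ : LinearRepresentation ι₂) : Prop where
  admissible : (R₁.directSum R₂).IsAdmissible
  irreducible₁ : R₁.M.IsIrreducible
  irreducible₂ : R₂.M.IsIrreducible
  ξ₁_ne_zero : R₁.ξ ≠ 0
  η₁_ne_zero : R₁.η ≠ 0
  ξ₂_ne_zero : R₂.ξ ≠ 0
  η₂_ne_zero : R₂.η ≠ 0

/-- An equipotent sum model: both components are primitive and have the same
Perron-Frobenius eigenvalue. -/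
structure IsEquipotentSumModel (R₁ : LinearRepresentation ι₁) (R₂ : LinearRepresentation ι₂) :
    Prop extends IsSumModel R₁ R₂ where
  primitive₁ : R₁.M.IsPrimitive
  primitive₂ : R₂.M.IsPrimitive
  equipotent : R₁.perronRoot = R₂.perronRoot

end LinearRepresentation

set_option linter.unusedSectionVars false

namespace Matrix

variable {ι : Type*} [Fintype ι]

theorem mulVec_pos_of_pos {P : Matrix ι ι ℝ} (hP : ∀ i j, 0 < P i j) {d : ι → ℝ}
    (hd : ∀ i, 0 ≤ d i) (hd0 : d ≠ 0) (i : ι) : 0 < (P *ᵥ d) i := by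
  obtain ⟨j, hj⟩ := Function.ne_iff.mp hd0
  exact Finset.sum_pos' (fun k _ => mul_nonneg (hP i k).le (hd k))
    ⟨j, Finset.mem_univ _, mul_pos (hP i j) (lt_of_le_of_ne (hd j) (Ne.symm hj))⟩

variable [DecidableEq ι]

theorem pow_mulVec_of_mulVec_eq_smul {S : Type*} [CommRing S] {P : Matrix ι ι S} {r : S}
    {x : ι → S} (h : P *ᵥ x = r • x) (n : ℕ) : (P ^ n) *ᵥ x = r ^ n • x := by
  induction n with
  | zero => simp
  | succ n ih => rw [pow_succ, ← mulVec_mulVec, h, mulVec_smul, ih, smul_smul, pow_succ, mul_comm]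

theorem vecMul_pow_of_vecMul_eq_smul {S : Type*} [CommRing S] {P : Matrix ι ι S} {r : S}
    {x : ι → S} (h : x ᵥ* P = r • x) (n : ℕ) : x ᵥ* (P ^ n) = r ^ n • x := by
  induction n with
  | zero => simp
  | succ n ih => rw [pow_succ, ← vecMul_vecMul, ih, smul_vecMul, h, smul_smul, pow_succ]

theorem IsPrimitive.transpose {P : Matrix ι ι ℝ} (hP : P.IsPrimitive) : Pᵀ.IsPrimitive := by
  obtain ⟨h0, k, hk, hpos⟩ := hP
  refine ⟨fun i j => h0 j i, k, hk, fun i j => ?_⟩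
  rw [← transpose_pow]
  exact hpos j i

/-- The existence part of the Perron-Frobenius theorem, by the Collatz-Wielandt argument. -/
theorem IsPrimitive.exists_pos_eigenvector [Nonempty ι] {P : Matrix ι ι ℝ}
    (hP : P.IsPrimitive) : ∃ r : ℝ, 0 < r ∧ ∃ x : ι → ℝ, (∀ i, 0 < x i) ∧ P *ᵥ x = r • x := by
  obtain ⟨h0, k, hk, hpos⟩ := hP
  set K : Set (ℝ × (ι → ℝ)) :=
    {p | 0 ≤ p.1 ∧ p.2 ∈ stdSimplex ℝ ι ∧ ∀ i, p.1 * p.2 i ≤ (P *ᵥ p.2) i} with hK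
  have hsub : K ⊆ Set.Icc 0 (∑ i, ∑ j, P i j) ×ˢ stdSimplex ℝ ι := by
    rintro ⟨r, x⟩ ⟨hr, hx, hle⟩
    refine ⟨⟨hr, ?_⟩, hx⟩
    calc r = ∑ i, r * x i := by rw [← Finset.mul_sum, hx.2, mul_one]
      _ ≤ ∑ i, (P *ᵥ x) i := Finset.sum_le_sum fun i _ => hle i
      _ ≤ ∑ i, ∑ j, P i j := Finset.sum_le_sum fun i _ => Finset.sum_le_sum fun j _ =>
          mul_le_of_le_one_right (h0 i j)
            ((Finset.single_le_sum (fun l _ => hx.1 l) (Finset.mem_univ j)).trans hx.2.le)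
  have hclosed : IsClosed K := by
    have hs := (isCompact_stdSimplex ℝ ι).isClosed
    have h3 : IsClosed (⋂ i, {p : ℝ × (ι → ℝ) | p.1 * p.2 i ≤ (P *ᵥ p.2) i}) :=
      isClosed_iInter fun i => isClosed_le (by fun_prop)
        ((continuous_apply i).comp (continuous_const.matrix_mulVec continuous_snd))
    have h1 : IsClosed {p : ℝ × (ι → ℝ) | 0 ≤ p.1} := isClosed_le continuous_const continuous_fst
    convert h1.inter ((hs.preimage continuous_snd).inter h3) using 1
    ext p
    simp [hK]
  have hcomp : IsCompact K :=
    (isCompact_Icc.prod (isCompact_stdSimplex ℝ ι)).of_isClosed_subset hclosed hsub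
  have hne : K.Nonempty := by
    obtain ⟨x, hx⟩ : (stdSimplex ℝ ι).Nonempty :=
      ⟨_, single_mem_stdSimplex ℝ (Classical.arbitrary ι)⟩
    refine ⟨(0, x), le_rfl, hx, fun i => ?_⟩
    rw [zero_mul]
    exact Finset.sum_nonneg fun j _ => mul_nonneg (h0 i j) (hx.1 j)
  obtain ⟨⟨r, x⟩, ⟨hr, hx, hle⟩, hmax⟩ := hcomp.exists_isMaxOn hne continuous_fst.continuousOn
  have hx0 : x ≠ 0 := by
    rintro rfl
    simpa using hx.2
  have hy := mulVec_pos_of_pos hpos hx.1 hx0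
  have heig : P *ᵥ x = r • x := by
    by_contra hne
    have hd := mulVec_pos_of_pos (d := P *ᵥ x - r • x) hpos
      (fun i => by simpa using hle i) (sub_ne_zero.mpr hne)
    set y := (P ^ k) *ᵥ x with hydef
    have hyd : (P ^ k) *ᵥ (P *ᵥ x - r • x) = P *ᵥ y - r • y := by
      rw [mulVec_sub, mulVec_smul, mulVec_mulVec, hydef, mulVec_mulVec, ← pow_succ, ← pow_succ']
    rw [hyd] at hd
    obtain ⟨i₀, -, hi₀⟩ := Finset.exists_min_image Finset.univ
      (fun i => (P *ᵥ y - r • y) i / y i) Finset.univ_nonempty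
    set ε := (P *ᵥ y - r • y) i₀ / y i₀ with hε
    have hεpos : 0 < ε := div_pos (hd i₀) (hy i₀)
    have hsum : 0 < ∑ i, y i := Finset.sum_pos (fun i _ => hy i) Finset.univ_nonempty
    have hmem : (r + ε, (∑ i, y i)⁻¹ • y) ∈ K := by
      refine ⟨by positivity, ⟨fun i => ?_, ?_⟩, fun i => ?_⟩
      · exact mul_nonneg (inv_nonneg.mpr hsum.le) (hy i).le
      · simp only [Pi.smul_apply, smul_eq_mul, ← Finset.mul_sum]
        exact inv_mul_cancel₀ hsum.ne'
      · simp only [mulVec_smul, Pi.smul_apply, smul_eq_mul]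
        rw [mul_left_comm]
        refine mul_le_mul_of_nonneg_left ?_ (inv_nonneg.mpr hsum.le)
        have h1 := hi₀ i (Finset.mem_univ i)
        rw [le_div_iff₀ (hy i)] at h1
        simp only [Pi.sub_apply, Pi.smul_apply, smul_eq_mul] at h1
        change ε * y i ≤ _ at h1
        linarith
    have := hmax hmem
    simp only [Set.mem_ofPred_eq] at this
    linarith
  rw [pow_mulVec_of_mulVec_eq_smul heig] at hy
  have hxpos : ∀ i, 0 < x i := fun i => by
    refine lt_of_le_of_ne (hx.1 i) fun h => ?_
    have := hy i
    rw [Pi.smul_apply, ← h, smul_zero] at this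
    exact lt_irrefl _ this
  refine ⟨r, lt_of_le_of_ne hr ?_, x, hxpos, heig⟩
  rintro rfl
  have := hy (Classical.arbitrary ι)
  simp [zero_pow hk.ne'] at this

/-- The eigenvalue of positive eigenvectors of a nonnegative matrix is its spectral radius. -/
theorem spectralRadius_toReal_of_pos_eigenvectors [Nonempty ι] {P : Matrix ι ι ℝ}
    (h0 : ∀ i j, 0 ≤ P i j)
    {r : ℝ} (hr : 0 < r) {x z : ι → ℝ} (hx : ∀ i, 0 < x i) (hz : ∀ i, 0 < z i)
    (hPx : P *ᵥ x = r • x) (hPz : z ᵥ* P = r • z) :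
    (spectralRadius ℂ (P.map ((↑) : ℝ → ℂ))).toReal = r := by
  have hsr : spectralRadius ℂ (P.map ((↑) : ℝ → ℂ)) = ENNReal.ofReal r := by
    refine le_antisymm ?_ ?_
    · refine iSup₂_le fun c hc => ?_
      rw [← Matrix.spectrum_toLin', ← Module.End.hasEigenvalue_iff_mem_spectrum] at hc
      obtain ⟨y, hy⟩ := hc.exists_hasEigenvector
      have hey : (P.map ((↑) : ℝ → ℂ)) *ᵥ y = c • y := by
        simpa using hy.apply_eq_smul
      have h1 : ∀ i, ‖c‖ * ‖y i‖ ≤ ∑ j, P i j * ‖y j‖ := fun i => by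
        calc ‖c‖ * ‖y i‖ = ‖(c • y) i‖ := by simp
          _ = ‖∑ j, (P i j : ℂ) * y j‖ := by rw [← hey]; rfl
          _ ≤ ∑ j, ‖(P i j : ℂ) * y j‖ := norm_sum_le _ _
          _ = _ := by simp [abs_of_nonneg (h0 i _)]
      have h2 : ‖c‖ * ∑ i, z i * ‖y i‖ ≤ r * ∑ i, z i * ‖y i‖ := by
        calc ‖c‖ * ∑ i, z i * ‖y i‖ = ∑ i, z i * (‖c‖ * ‖y i‖) := by
              rw [Finset.mul_sum]; exact Finset.sum_congr rfl fun _ _ => by ring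
          _ ≤ ∑ i, z i * ∑ j, P i j * ‖y j‖ :=
              Finset.sum_le_sum fun i _ => mul_le_mul_of_nonneg_left (h1 i) (hz i).le
          _ = ∑ j, (z ᵥ* P) j * ‖y j‖ := by
              simp only [Matrix.vecMul, dotProduct, Finset.mul_sum, Finset.sum_mul]
              rw [Finset.sum_comm]
              exact Finset.sum_congr rfl fun _ _ => Finset.sum_congr rfl fun _ _ => by ring
          _ = _ := by
              rw [hPz, Finset.mul_sum]
              exact Finset.sum_congr rfl fun _ _ => by simp [mul_assoc]
      have h3 : 0 < ∑ i, z i * ‖y i‖ := by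
        obtain ⟨i, hi⟩ := Function.ne_iff.mp hy.2
        exact Finset.sum_pos' (fun k _ => mul_nonneg (hz k).le (norm_nonneg _))
          ⟨i, Finset.mem_univ _, mul_pos (hz i) (norm_pos_iff.mpr hi)⟩
      have h4 := le_of_mul_le_mul_right h2 h3
      rw [← ENNReal.ofReal_coe_nnreal, coe_nnnorm]
      exact ENNReal.ofReal_le_ofReal h4
    · have hmem : (r : ℂ) ∈ spectrum ℂ (P.map ((↑) : ℝ → ℂ)) := by
        rw [← Matrix.spectrum_toLin', ← Module.End.hasEigenvalue_iff_mem_spectrum]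
        refine Module.End.hasEigenvalue_of_hasEigenvector (x := fun i => (x i : ℂ)) ⟨?_, ?_⟩
        · rw [Module.End.mem_eigenspace_iff, Matrix.toLin'_apply]
          ext i
          have := congrArg ((↑) : ℝ → ℂ) (congrFun hPx i)
          simpa [Matrix.mulVec, dotProduct] using this
        · intro h
          have := congrFun h (Classical.arbitrary ι)
          simp [(hx _).ne'] at this
      calc ENNReal.ofReal r = (‖(r : ℂ)‖₊ : ENNReal) := by
            rw [← ENNReal.ofReal_coe_nnreal, coe_nnnorm, Complex.norm_real,
              Real.norm_of_nonneg hr.le]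
        _ ≤ _ := le_iSup₂ (f := fun c (_ : c ∈ spectrum ℂ (P.map ((↑) : ℝ → ℂ))) =>
            (‖c‖₊ : ENNReal)) _ hmem
  rw [hsr, ENNReal.toReal_ofReal hr.le]

end Matrix

namespace LinearRepresentation

variable {ι : Type*} [Fintype ι] [DecidableEq ι]

theorem exists_isPerronPair [Nonempty ι] (R : LinearRepresentation ι) (hR : R.M.IsPrimitive) :
    0 < R.perronRoot ∧ ∃ p, R.IsPerronPair p := by
  obtain ⟨r, hr, x, hx, hMx⟩ := hR.exists_pos_eigenvector
  obtain ⟨s, hs, z, hz, hMz⟩ := hR.transpose.exists_pos_eigenvector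
  rw [Matrix.mulVec_transpose] at hMz
  have hzx : 0 < z ⬝ᵥ x :=
    Finset.sum_pos (fun i _ => mul_pos (hz i) (hx i)) Finset.univ_nonempty
  have hrs : s = r := by
    have h : (z ᵥ* R.M) ⬝ᵥ x = z ⬝ᵥ (R.M *ᵥ x) := (Matrix.dotProduct_mulVec _ _ _).symm
    rw [hMx, hMz, smul_dotProduct, dotProduct_smul] at h
    exact mul_right_cancel₀ hzx.ne' h
  subst hrs
  have hroot : R.perronRoot = s :=
    Matrix.spectralRadius_toReal_of_pos_eigenvectors hR.nonneg hs hx hz hMx hMz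
  refine ⟨hroot ▸ hs, ((z ⬝ᵥ x)⁻¹ • z, x), ?_, hx, ?_, ?_, ?_⟩
  · exact fun i => mul_pos (inv_pos.mpr hzx) (hz i)
  · rw [Matrix.smul_vecMul, hMz, hroot, smul_comm]
  · rw [hroot]; exact hMx
  · simp only [smul_dotProduct, smul_eq_mul]
    exact inv_mul_cancel₀ hzx.ne'

theorem perronRoot_pos [Nonempty ι] (R : LinearRepresentation ι) (hR : R.M.IsPrimitive) :
    0 < R.perronRoot := (R.exists_isPerronPair hR).1

theorem isPerronPair_perronPair [Nonempty ι] (R : LinearRepresentation ι)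
    (hR : R.M.IsPrimitive) : R.IsPerronPair R.perronPair :=
  Classical.epsilon_spec (R.exists_isPerronPair hR).2

end LinearRepresentation

namespace Matrix

variable {ι : Type*} [Fintype ι]

section Norm

open scoped Matrix.Norms.Operator

theorem linfty_opNorm_le_iff {κ : Type*} [Fintype κ] {X : Matrix ι κ ℂ} {c : ℝ} (hc : 0 ≤ c) :
    ‖X‖ ≤ c ↔ ∀ i, ∑ j, ‖X i j‖ ≤ c := by
  lift c to NNReal using hc
  rw [linfty_opNorm_def, NNReal.coe_le_coe, Finset.sup_le_iff]
  simp [← NNReal.coe_le_coe]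

theorem linfty_opNorm_lt_iff {κ : Type*} [Fintype κ] {X : Matrix ι κ ℂ} {c : ℝ} (hc : 0 < c) :
    ‖X‖ < c ↔ ∀ i, ∑ j, ‖X i j‖ < c := by
  lift c to NNReal using hc.le
  rw [linfty_opNorm_def, NNReal.coe_lt_coe, Finset.sup_lt_iff (by exact_mod_cast hc)]
  simp [← NNReal.coe_lt_coe]

end Norm

end Matrix

theorem sub_smul_pow_of_absorbing {S A : Type*} [CommRing S] [Ring A] [Algebra S A]
    {x e : A} {c : S} (hxe : x * e = c • e) (hex : e * x = c • e) (hee : e * e = e) (n : ℕ) :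
    (x - c • e) ^ (n + 1) = x ^ (n + 1) - c ^ (n + 1) • e := by
  have h : ∀ n, x ^ n * e = c ^ n • e := fun n => by
    induction n with
    | zero => simp
    | succ n ih => rw [pow_succ, mul_assoc, hxe, mul_smul_comm, ih, smul_smul, pow_succ, mul_comm]
  induction n with
  | zero => simp
  | succ n ih =>
    rw [pow_succ, ih, sub_mul, mul_sub, mul_sub, ← pow_succ, mul_smul_comm, h, smul_mul_assoc, hex,
      smul_mul_smul_comm, hee, smul_smul, smul_smul, ← pow_succ, mul_comm c, ← pow_succ]
    abel

namespace LinearRepresentation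

variable {ι : Type*} [Fintype ι] [DecidableEq ι]

/-- The matrix `A e^z + B`. -/
noncomputable def twist (R : LinearRepresentation ι) (z : ℂ) : Matrix ι ι ℂ :=
  Complex.exp z • R.A.map ((↑) : ℝ → ℂ) + R.B.map ((↑) : ℝ → ℂ)

theorem twist_zero (R : LinearRepresentation ι) : R.twist 0 = R.M.map ((↑) : ℝ → ℂ) := by
  ext i j
  simp [twist, M]

/-- `M` is a primitive stochastic matrix with stationary distribution `p`. -/
structure IsStochastic (R : LinearRepresentation ι) (p : ι → ℝ) : Prop where
  primitive : R.M.IsPrimitive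
  row_sum : R.M *ᵥ 1 = 1
  pos : ∀ i, 0 < p i
  stationary : p ᵥ* R.M = p
  total : ∑ i, p i = 1

/-- The rank one limit of the powers of a stochastic matrix with stationary distribution `p`. -/
def stationaryMatrix (p : ι → ℝ) : Matrix ι ι ℂ := Matrix.of fun _ j => (p j : ℂ)

namespace IsStochastic

variable {R : LinearRepresentation ι} {p : ι → ℝ}

theorem twist_zero_mulVec_one (h : R.IsStochastic p) : R.twist 0 *ᵥ 1 = 1 := by
  ext i
  have := congrArg ((↑) : ℝ → ℂ) (congrFun h.row_sum i)
  simpa [twist_zero, Matrix.mulVec, dotProduct] using this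

theorem vecMul_twist_zero (h : R.IsStochastic p) :
    (fun i => (p i : ℂ)) ᵥ* R.twist 0 = fun i => (p i : ℂ) := by
  ext i
  have := congrArg ((↑) : ℝ → ℂ) (congrFun h.stationary i)
  simpa [twist_zero, Matrix.vecMul, dotProduct] using this

theorem complex_total (h : R.IsStochastic p) : ∑ i, (p i : ℂ) = 1 := by
  exact_mod_cast h.total

theorem nonempty (h : R.IsStochastic p) : Nonempty ι := by
  by_contra hne
  rw [not_nonempty_iff] at hne
  simpa using h.total

theorem stationaryMatrix_mulVec (y : ι → ℂ) :
    stationaryMatrix p *ᵥ y = ((fun i => (p i : ℂ)) ⬝ᵥ y) • 1 := by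
  ext i
  simp [stationaryMatrix, Matrix.mulVec, dotProduct]

theorem vecMul_stationaryMatrix (y : ι → ℂ) :
    y ᵥ* stationaryMatrix p = (∑ i, y i) • fun i => (p i : ℂ) := by
  ext i
  simp [stationaryMatrix, Matrix.vecMul, dotProduct, Finset.sum_mul]

theorem mul_stationaryMatrix {X : Matrix ι ι ℂ} {c : ℂ} (hX : X *ᵥ 1 = c • 1) :
    X * stationaryMatrix p = c • stationaryMatrix p := by
  ext i j
  have := congrFun hX i
  simp only [Matrix.mulVec, dotProduct, Pi.one_apply, mul_one, Pi.smul_apply, smul_eq_mul] at this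
  simp [stationaryMatrix, Matrix.mul_apply, ← Finset.sum_mul, this]

theorem stationaryMatrix_mul {X : Matrix ι ι ℂ} {c : ℂ}
    (hX : (fun i => (p i : ℂ)) ᵥ* X = c • fun i => (p i : ℂ)) :
    stationaryMatrix p * X = c • stationaryMatrix p := by
  ext i j
  have := congrFun hX j
  simpa [stationaryMatrix, Matrix.mul_apply, Matrix.vecMul, dotProduct] using this

theorem stationaryMatrix_mul_self (h : R.IsStochastic p) :
    stationaryMatrix p * stationaryMatrix p = stationaryMatrix p := by
  have := mul_stationaryMatrix (p := p) (X := stationaryMatrix p) (c := 1) (by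
    rw [stationaryMatrix_mulVec]; simp [dotProduct, h.complex_total])
  simpa using this

theorem twist_zero_mul_stationaryMatrix (h : R.IsStochastic p) :
    R.twist 0 * stationaryMatrix p = stationaryMatrix p := by
  have := mul_stationaryMatrix (p := p) (X := R.twist 0) (c := 1)
    (by rw [h.twist_zero_mulVec_one, one_smul])
  simpa using this

theorem stationaryMatrix_mul_twist_zero (h : R.IsStochastic p) :
    stationaryMatrix p * R.twist 0 = stationaryMatrix p := by
  have := stationaryMatrix_mul (p := p) (X := R.twist 0) (c := 1)
    (by rw [h.vecMul_twist_zero, one_smul])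
  simpa using this

theorem p_le_one (h : R.IsStochastic p) (i : ι) : p i ≤ 1 :=
  (Finset.single_le_sum (fun j _ => (h.pos j).le) (Finset.mem_univ i)).trans h.total.le

open scoped Matrix.Norms.Operator in
/-- Doeblin's argument: the powers of a primitive stochastic matrix converge geometrically. -/
theorem exists_pow_norm_lt_one (h : R.IsStochastic p) :
    ∃ L, 0 < L ∧ ‖(R.twist 0 - stationaryMatrix p) ^ L‖ < 1 := by
  have := h.nonempty
  obtain ⟨k, hk, hpos⟩ := h.primitive.exists_pos_pow
  obtain ⟨ε, hε0, hε1, hε⟩ : ∃ ε : ℝ, 0 < ε ∧ ε < 1 ∧ ∀ i j, ε ≤ (R.M ^ k) i j := by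
    obtain ⟨q, -, hq⟩ := Finset.exists_min_image Finset.univ
      (fun q : ι × ι => (R.M ^ k) q.1 q.2) Finset.univ_nonempty
    exact ⟨min ((R.M ^ k) q.1 q.2) (1 / 2), lt_min (hpos _ _) (by norm_num),
      (min_le_right _ _).trans_lt (by norm_num),
      fun i j => (min_le_left _ _).trans (hq (i, j) (Finset.mem_univ _))⟩
  set E := stationaryMatrix p with hE
  set W : Matrix ι ι ℂ := R.twist 0 ^ k - (ε : ℂ) • E with hW
  have hTk1 : R.twist 0 ^ k *ᵥ 1 = 1 := by
    simpa using Matrix.pow_mulVec_of_mulVec_eq_smul (r := (1 : ℂ))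
      (by rw [h.twist_zero_mulVec_one, one_smul]) k
  have hTkp : (fun i => (p i : ℂ)) ᵥ* R.twist 0 ^ k = fun i => (p i : ℂ) := by
    simpa using Matrix.vecMul_pow_of_vecMul_eq_smul (r := (1 : ℂ))
      (by rw [h.vecMul_twist_zero, one_smul]) k
  have hW1 : W *ᵥ 1 = ((1 - ε : ℝ) : ℂ) • 1 := by
    rw [hW, Matrix.sub_mulVec, Matrix.smul_mulVec, hTk1, hE, stationaryMatrix_mulVec]
    ext i
    simp [dotProduct, h.complex_total]
  have hWp : (fun i => (p i : ℂ)) ᵥ* W = ((1 - ε : ℝ) : ℂ) • fun i => (p i : ℂ) := by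
    rw [hW, Matrix.vecMul_sub, Matrix.vecMul_smul, hTkp, hE, vecMul_stationaryMatrix,
      h.complex_total]
    ext i
    simp
    ring
  have hWE := mul_stationaryMatrix (p := p) hW1
  have hEW := stationaryMatrix_mul hWp
  have hTk : (R.twist 0 - E) ^ k = W - ((1 - ε : ℝ) : ℂ) • E := by
    obtain ⟨k, rfl⟩ : ∃ m, k = m + 1 := ⟨k - 1, by omega⟩
    have := sub_smul_pow_of_absorbing (S := ℂ) (x := R.twist 0) (e := E) (c := 1)
      (by rw [one_smul, h.twist_zero_mul_stationaryMatrix])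
      (by rw [one_smul, h.stationaryMatrix_mul_twist_zero]) h.stationaryMatrix_mul_self k
    rw [one_smul, one_pow, one_smul] at this
    rw [this, hW]
    push_cast
    module
  have hentry : R.twist 0 ^ k = (R.M ^ k).map ((↑) : ℝ → ℂ) := by
    rw [twist_zero]
    exact (Matrix.map_pow R.M Complex.ofRealHom k).symm
  have hWnorm : ‖W‖ ≤ 1 - ε := by
    rw [Matrix.linfty_opNorm_le_iff (by linarith)]
    intro i
    have h1 : ∀ j, ‖W i j‖ = (R.M ^ k) i j - ε * p j := fun j => by
      have h2 : W i j = (((R.M ^ k) i j - ε * p j : ℝ) : ℂ) := by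
        simp [hW, hE, hentry, stationaryMatrix]
      rw [h2, Complex.norm_real, Real.norm_of_nonneg]
      nlinarith [hε i j, h.p_le_one j]
    have h3 : ∑ j, (R.M ^ k) i j = 1 := by
      have := congrFun (Matrix.pow_mulVec_of_mulVec_eq_smul (r := (1 : ℝ)) (P := R.M) (x := 1)
        (by rw [h.row_sum, one_smul]) k) i
      simpa [Matrix.mulVec, dotProduct] using this
    simp only [h1, Finset.sum_sub_distrib, ← Finset.mul_sum, h.total, h3, mul_one, le_refl]
  have hEnorm : ‖E‖ ≤ 1 := by
    rw [Matrix.linfty_opNorm_le_iff zero_le_one]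
    intro i
    simp [hE, stationaryMatrix, abs_of_pos (h.pos _), h.total]
  obtain ⟨j, hj⟩ := exists_pow_lt_of_lt_one (show (0 : ℝ) < 1 / 2 by norm_num)
    (show 1 - ε < 1 by linarith)
  have hj' : (1 - ε) ^ (j + 1) < 1 / 2 :=
    (pow_le_pow_of_le_one (by linarith) (by linarith) (Nat.le_succ j)).trans_lt hj
  refine ⟨k * (j + 1), by positivity, ?_⟩
  rw [pow_mul, hTk, sub_smul_pow_of_absorbing hWE hEW h.stationaryMatrix_mul_self j]
  calc ‖W ^ (j + 1) - ((1 - ε : ℝ) : ℂ) ^ (j + 1) • E‖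
      ≤ ‖W ^ (j + 1)‖ + ‖((1 - ε : ℝ) : ℂ) ^ (j + 1) • E‖ := norm_sub_le _ _
    _ ≤ (1 - ε) ^ (j + 1) + (1 - ε) ^ (j + 1) * 1 := by
        refine add_le_add ((norm_pow_le' _ (Nat.succ_pos j)).trans ?_) ?_
        · exact pow_le_pow_left₀ (norm_nonneg _) hWnorm _
        · rw [norm_smul, norm_pow, Complex.norm_real, Real.norm_of_nonneg (by linarith)]
          exact mul_le_mul_of_nonneg_left hEnorm (by positivity [show 0 ≤ 1 - ε by linarith])
    _ < 1 := by linarith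

theorem sub_stationary_mulVec_fixed (h : R.IsStochastic p) {y : ι → ℂ}
    (hy : (R.twist 0 - stationaryMatrix p) *ᵥ y = y) : y = 0 := by
  open scoped Matrix.Norms.Operator in
  obtain ⟨L, -, hL⟩ := h.exists_pow_norm_lt_one
  have h1 := Matrix.pow_mulVec_of_mulVec_eq_smul (r := (1 : ℂ)) (by rw [hy, one_smul]) L
  rw [one_pow, one_smul] at h1
  by_contra h0
  have h2 := Matrix.linfty_opNorm_mulVec ((R.twist 0 - stationaryMatrix p) ^ L) y
  rw [h1] at h2
  have h3 := norm_pos_iff.mpr h0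
  nlinarith

/-- The characteristic polynomial of `M` with its limit matrix removed. -/
noncomputable def cofactor (R : LinearRepresentation ι) (p : ι → ℝ) (x : ℂ) : ℂ :=
  (x • (1 : Matrix ι ι ℂ) - (R.twist 0 - stationaryMatrix p)).det

theorem cofactor_ne_zero (h : R.IsStochastic p) : cofactor R p 1 ≠ 0 := by
  intro h0
  rw [cofactor, ← Matrix.exists_mulVec_eq_zero_iff] at h0
  obtain ⟨v, hv, hv0⟩ := h0
  refine hv (h.sub_stationary_mulVec_fixed ?_)
  rw [one_smul, Matrix.sub_mulVec, Matrix.one_mulVec, sub_eq_zero] at hv0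
  exact hv0.symm

theorem det_smul_one_sub_twist_zero (h : R.IsStochastic p) {x : ℂ} (hx : x ≠ 0) :
    (x • (1 : Matrix ι ι ℂ) - R.twist 0).det = cofactor R p x * (1 - x⁻¹) := by
  set E := stationaryMatrix p with hE
  have h1 : x • (1 : Matrix ι ι ℂ) - R.twist 0 =
      (x • (1 : Matrix ι ι ℂ) - (R.twist 0 - E)) * (1 - x⁻¹ • E) := by
    have h2 : (x • (1 : Matrix ι ι ℂ) - (R.twist 0 - E)) * E = x • E := by
      rw [sub_mul, sub_mul, h.twist_zero_mul_stationaryMatrix, h.stationaryMatrix_mul_self,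
        smul_mul_assoc, one_mul, sub_self, sub_zero]
    rw [mul_sub, mul_one, mul_smul_comm, h2, smul_smul, inv_mul_cancel₀ hx, one_smul]
    abel
  have h3 : (1 - x⁻¹ • E).det = 1 - x⁻¹ := by
    have h4 : 1 - x⁻¹ • E = 1 + Matrix.replicateCol Unit (fun _ => -x⁻¹) *
        Matrix.replicateRow Unit (fun j => (p j : ℂ)) := by
      ext i j
      simp [hE, stationaryMatrix, Matrix.mul_apply]
      ring
    rw [h4, Matrix.det_one_add_replicateCol_mul_replicateRow]
    simp [dotProduct, ← Finset.sum_mul, h.complex_total]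
    ring
  rw [h1, Matrix.det_mul, h3, cofactor]

theorem eq_smul_one_of_twist_zero_mulVec (h : R.IsStochastic p) {y : ι → ℂ}
    (hy : R.twist 0 *ᵥ y = y) : y = ((fun i => (p i : ℂ)) ⬝ᵥ y) • 1 := by
  rw [← sub_eq_zero]
  apply h.sub_stationary_mulVec_fixed
  rw [Matrix.sub_mulVec, Matrix.mulVec_sub, Matrix.mulVec_smul, hy, h.twist_zero_mulVec_one,
    stationaryMatrix_mulVec, dotProduct_sub, dotProduct_smul]
  simp [dotProduct, h.complex_total]

theorem continuous_cofactor : Continuous (cofactor R p) := by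
  unfold cofactor
  fun_prop

theorem adjugate_mulVec_one (h : R.IsStochastic p) :
    ((1 : Matrix ι ι ℂ) - R.twist 0).adjugate *ᵥ 1 = cofactor R p 1 • 1 := by
  have hlim1 : Filter.Tendsto (fun x : ℂ => (x • (1 : Matrix ι ι ℂ) - R.twist 0).adjugate *ᵥ 1)
      (nhdsWithin 1 {1}ᶜ) (nhds (((1 : Matrix ι ι ℂ) - R.twist 0).adjugate *ᵥ 1)) := by
    have : Continuous fun x : ℂ => (x • (1 : Matrix ι ι ℂ) - R.twist 0).adjugate *ᵥ 1 := by
      fun_prop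
    simpa using (this.tendsto 1).mono_left nhdsWithin_le_nhds
  have hlim2 : Filter.Tendsto (fun x : ℂ => (cofactor R p x * x⁻¹) • (1 : ι → ℂ))
      (nhdsWithin 1 {1}ᶜ) (nhds (cofactor R p 1 • 1)) := by
    have : ContinuousAt (fun x : ℂ => (cofactor R p x * x⁻¹) • (1 : ι → ℂ)) 1 :=
      (continuous_cofactor.continuousAt.mul (continuousAt_inv₀ one_ne_zero)).smul
        continuousAt_const
    simpa using this.tendsto.mono_left nhdsWithin_le_nhds
  refine tendsto_nhds_unique hlim1 (hlim2.congr' ?_)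
  have h0 : ∀ᶠ x : ℂ in nhdsWithin 1 {1}ᶜ, x ≠ 0 :=
    nhdsWithin_le_nhds (eventually_ne_nhds one_ne_zero)
  filter_upwards [h0, self_mem_nhdsWithin] with x hx0 hx1
  have hx1 : x - 1 ≠ 0 := sub_ne_zero.mpr hx1
  have h2 : (x • (1 : Matrix ι ι ℂ) - R.twist 0) *ᵥ 1 = (x - 1) • 1 := by
    rw [Matrix.sub_mulVec, Matrix.smul_mulVec, Matrix.one_mulVec, h.twist_zero_mulVec_one,
      sub_smul, one_smul]
  have h3 := congrArg ((x • (1 : Matrix ι ι ℂ) - R.twist 0).adjugate *ᵥ ·) h2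
  simp only [Matrix.mulVec_mulVec, Matrix.adjugate_mul, Matrix.smul_mulVec, Matrix.one_mulVec,
    Matrix.mulVec_smul, h.det_smul_one_sub_twist_zero hx0] at h3
  have h4 := congrArg ((x - 1)⁻¹ • ·) h3
  simp only [smul_smul, inv_mul_cancel₀ hx1, one_smul] at h4
  rw [← h4]
  congr 1
  field_simp

theorem vecMul_adjugate (h : R.IsStochastic p) :
    (fun i => (p i : ℂ)) ᵥ* ((1 : Matrix ι ι ℂ) - R.twist 0).adjugate =
      cofactor R p 1 • fun i => (p i : ℂ) := by
  set q : ι → ℂ := fun i => (p i : ℂ) with hq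
  have hlim1 : Filter.Tendsto (fun x : ℂ => q ᵥ* (x • (1 : Matrix ι ι ℂ) - R.twist 0).adjugate)
      (nhdsWithin 1 {1}ᶜ) (nhds (q ᵥ* ((1 : Matrix ι ι ℂ) - R.twist 0).adjugate)) := by
    have : Continuous fun x : ℂ => q ᵥ* (x • (1 : Matrix ι ι ℂ) - R.twist 0).adjugate := by
      fun_prop
    simpa using (this.tendsto 1).mono_left nhdsWithin_le_nhds
  have hlim2 : Filter.Tendsto (fun x : ℂ => (cofactor R p x * x⁻¹) • q)
      (nhdsWithin 1 {1}ᶜ) (nhds (cofactor R p 1 • q)) := by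
    have : ContinuousAt (fun x : ℂ => (cofactor R p x * x⁻¹) • q) 1 :=
      (continuous_cofactor.continuousAt.mul (continuousAt_inv₀ one_ne_zero)).smul
        continuousAt_const
    simpa using this.tendsto.mono_left nhdsWithin_le_nhds
  refine tendsto_nhds_unique hlim1 (hlim2.congr' ?_)
  have h0 : ∀ᶠ x : ℂ in nhdsWithin 1 {1}ᶜ, x ≠ 0 :=
    nhdsWithin_le_nhds (eventually_ne_nhds one_ne_zero)
  filter_upwards [h0, self_mem_nhdsWithin] with x hx0 hx1
  have hx1 : x - 1 ≠ 0 := sub_ne_zero.mpr hx1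
  have h2 : q ᵥ* (x • (1 : Matrix ι ι ℂ) - R.twist 0) = (x - 1) • q := by
    rw [Matrix.vecMul_sub, Matrix.vecMul_smul, Matrix.vecMul_one, h.vecMul_twist_zero,
      sub_smul, one_smul]
  have h3 := congrArg (· ᵥ* (x • (1 : Matrix ι ι ℂ) - R.twist 0).adjugate) h2
  simp only [Matrix.vecMul_vecMul, Matrix.mul_adjugate, Matrix.vecMul_smul, Matrix.vecMul_one,
    Matrix.smul_vecMul, h.det_smul_one_sub_twist_zero hx0] at h3
  have h4 := congrArg ((x - 1)⁻¹ • ·) h3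
  simp only [smul_smul, inv_mul_cancel₀ hx1, one_smul] at h4
  rw [← h4]
  congr 1
  field_simp

end IsStochastic

end LinearRepresentation

section Analytic

variable {F : Type*} [NormedAddCommGroup F] [NormedSpace ℂ F] {ι : Type*} [Fintype ι]
  [DecidableEq ι]

theorem AnalyticAt.matrix_det {X : F → Matrix ι ι ℂ} {x : F}
    (hX : ∀ i j, AnalyticAt ℂ (fun y => X y i j) x) : AnalyticAt ℂ (fun y => (X y).det) x := by
  simp only [Matrix.det_apply, Units.smul_def, zsmul_eq_mul]
  exact Finset.analyticAt_fun_sum _ fun s _ => analyticAt_const.mul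
    (Finset.analyticAt_fun_prod _ fun i _ => hX _ _)

theorem AnalyticAt.matrix_adjugate {X : F → Matrix ι ι ℂ} {x : F}
    (hX : ∀ i j, AnalyticAt ℂ (fun y => X y i j) x) (i j : ι) :
    AnalyticAt ℂ (fun y => (X y).adjugate i j) x := by
  simp only [Matrix.adjugate_apply]
  refine AnalyticAt.matrix_det fun k l => ?_
  by_cases hk : k = j
  · subst hk
    simpa using analyticAt_const
  · simpa [Matrix.updateRow_ne hk] using hX k l

end Analytic

section PowBound

theorem add_one_mul_pow_le {r : ℝ} (h0 : 0 ≤ r) (h1 : r < 1) (q : ℕ) :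
    (q + 1) * r ^ q ≤ (1 - r)⁻¹ := by
  calc (q + 1) * r ^ q = ∑ _j ∈ Finset.range (q + 1), r ^ q := by simp
    _ ≤ ∑ j ∈ Finset.range (q + 1), r ^ j := Finset.sum_le_sum fun j hj =>
        pow_le_pow_of_le_one h0 h1.le (Nat.lt_succ_iff.mp (Finset.mem_range.mp hj))
    _ ≤ (1 - r)⁻¹ := by
        rw [← tsum_geometric_of_lt_one h0 h1]
        exact (summable_geometric_of_lt_one h0 h1).sum_le_tsum _ fun _ _ => pow_nonneg h0 _

theorem natCast_mul_norm_pow_le {A : Type*} [NormedRing A] [NormOneClass A] {L : ℕ} (hL : 0 < L)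
    {r K : ℝ} (h0 : 0 ≤ r) (h1 : r < 1) (hK : 1 ≤ K) {x : A} (hxL : ‖x ^ L‖ ≤ r) (hx : ‖x‖ ≤ K)
    (n : ℕ) : n * ‖x ^ n‖ ≤ L * K ^ L * (1 - r)⁻¹ := by
  have hn : (n : ℝ) ≤ L * ((n / L : ℕ) + 1) := by
    exact_mod_cast (Nat.lt_mul_div_succ n hL).le
  have hpow : ‖x ^ n‖ ≤ r ^ (n / L) * K ^ L := by
    calc ‖x ^ n‖ = ‖(x ^ L) ^ (n / L) * x ^ (n % L)‖ := by
          rw [← pow_mul, ← pow_add, Nat.div_add_mod]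
      _ ≤ ‖x ^ L‖ ^ (n / L) * ‖x‖ ^ (n % L) := (norm_mul_le _ _).trans
          (mul_le_mul (norm_pow_le _ _) (norm_pow_le _ _) (norm_nonneg _) (by positivity))
      _ ≤ r ^ (n / L) * K ^ L := by
          refine mul_le_mul (pow_le_pow_left₀ (norm_nonneg _) hxL _) ?_ (by positivity)
            (by positivity)
          exact (pow_le_pow_left₀ (norm_nonneg _) hx _).trans
            (pow_le_pow_right₀ hK (Nat.mod_lt _ hL).le)
  calc n * ‖x ^ n‖ ≤ (L * ((n / L : ℕ) + 1)) * (r ^ (n / L) * K ^ L) :=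
        mul_le_mul hn hpow (norm_nonneg _) (by positivity)
    _ = L * K ^ L * (((n / L : ℕ) + 1) * r ^ (n / L)) := by ring
    _ ≤ _ := mul_le_mul_of_nonneg_left (add_one_mul_pow_le h0 h1 _) (by positivity)

end PowBound

namespace LinearRepresentation

variable {ι : Type*} [Fintype ι] [DecidableEq ι]

theorem analyticAt_twist (R : LinearRepresentation ι) (z : ℂ) (i j : ι) :
    AnalyticAt ℂ (fun y => R.twist y i j) z := by
  simp only [twist, Matrix.add_apply, Matrix.smul_apply, smul_eq_mul]
  fun_prop

theorem continuous_twist (R : LinearRepresentation ι) : Continuous R.twist := by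
  unfold twist
  fun_prop

/-- `U` is analytic at `0`, with `U 0 = 1` and `det (U z - A e^z - B) = 0` near `0`. -/
structure IsBranch (R : LinearRepresentation ι) (U : ℂ → ℂ) : Prop where
  analyticAt : AnalyticAt ℂ U 0
  apply_zero : U 0 = 1
  det_eq_zero : ∀ᶠ z in nhds (0 : ℂ), (U z • (1 : Matrix ι ι ℂ) - R.twist z).det = 0

namespace IsStochastic

variable {R : LinearRepresentation ι} {p : ι → ℝ}

theorem exists_isBranch (h : R.IsStochastic p) : ∃ U, R.IsBranch U := by
  set f : ℂ × ℂ → ℂ := fun q => (q.2 • (1 : Matrix ι ι ℂ) - R.twist q.1).det with hf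
  have hfa : AnalyticAt ℂ f (0, 1) := by
    refine AnalyticAt.matrix_det fun i j => ?_
    simp only [Matrix.sub_apply, Matrix.smul_apply, smul_eq_mul]
    exact (analyticAt_snd.mul analyticAt_const).sub
      ((R.analyticAt_twist 0 i j).comp_of_eq analyticAt_fst rfl)
  have hf01 : f (0, 1) = 0 := by
    simp [hf, h.det_smul_one_sub_twist_zero one_ne_zero]
  have hfd := hfa.differentiableAt.hasFDerivAt
  have hd1 : HasDerivAt (fun x : ℂ => f (0, x)) (fderiv ℂ f (0, 1) (0, 1)) 1 :=
    hfd.comp_hasDerivAt (x := (1 : ℂ)) (f := fun x : ℂ => ((0 : ℂ), x))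
      ((hasDerivAt_const _ _).prodMk (hasDerivAt_id _))
  have hd2 : HasDerivAt (fun x : ℂ => f (0, x)) (cofactor R p 1) 1 := by
    have hca : AnalyticAt ℂ (cofactor R p) 1 := by
      refine AnalyticAt.matrix_det fun i j => ?_
      simp only [Matrix.sub_apply, Matrix.smul_apply, smul_eq_mul]
      fun_prop
    have h1 : HasDerivAt (fun x : ℂ => 1 - x⁻¹) 1 1 := by
      simpa using (hasDerivAt_inv (one_ne_zero (α := ℂ))).const_sub 1
    have h2 := hca.differentiableAt.hasDerivAt.mul h1
    simp only [inv_one, sub_self, mul_zero, zero_add, mul_one] at h2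
    refine h2.congr_of_eventuallyEq ?_
    filter_upwards [eventually_ne_nhds (one_ne_zero (α := ℂ))] with x hx
    simp [hf, h.det_smul_one_sub_twist_zero hx]
  have hne : fderiv ℂ f (0, 1) (0, 1) ≠ 0 := by
    rw [hd1.unique hd2]
    exact h.cofactor_ne_zero
  have hinv : (fderiv ℂ f (0, 1) ∘L .inr ℂ ℂ ℂ).IsInvertible := by
    refine ⟨ContinuousLinearEquiv.unitsEquivAut ℂ (Units.mk0 _ hne), ?_⟩
    ext
    simp
  have hcd : ContDiffAt ℂ ⊤ f (0, 1) := hfa.contDiffAt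
  refine ⟨hcd.implicitFunction (by simp) hinv, ?_, hcd.implicitFunction_apply_self (by simp) hinv,
    ?_⟩
  · exact (hcd.contDiffAt_implicitFunction (by simp) hinv).analyticAt
  · have := hcd.eventually_apply_implicitFunction (by simp) hinv
    rw [hf01] at this
    exact this

theorem exists_eigenvectors (h : R.IsStochastic p) {U : ℂ → ℂ} (hU : R.IsBranch U) :
    ∃ v w : ℂ → ι → ℂ, (∀ i, AnalyticAt ℂ (v · i) 0) ∧ (∀ i, AnalyticAt ℂ (w · i) 0) ∧
      v 0 = 1 ∧ w 0 = (fun i => (p i : ℂ)) ∧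
      ∀ᶠ z in nhds (0 : ℂ), R.twist z *ᵥ v z = U z • v z ∧ w z ᵥ* R.twist z = U z • w z := by
  set N : ℂ → Matrix ι ι ℂ := fun z => (U z • (1 : Matrix ι ι ℂ) - R.twist z).adjugate with hN
  have hNa : ∀ i j, AnalyticAt ℂ (fun z => N z i j) 0 := fun i j => by
    refine AnalyticAt.matrix_adjugate (fun k l => ?_) i j
    simp only [Matrix.sub_apply, Matrix.smul_apply, smul_eq_mul]
    exact (hU.analyticAt.mul analyticAt_const).sub (R.analyticAt_twist 0 k l)
  have hc := h.cofactor_ne_zero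
  refine ⟨fun z => (cofactor R p 1)⁻¹ • (N z *ᵥ 1),
    fun z => (cofactor R p 1)⁻¹ • ((fun i => (p i : ℂ)) ᵥ* N z), fun i => ?_, fun i => ?_, ?_, ?_,
    ?_⟩
  · simp only [Pi.smul_apply, smul_eq_mul, Matrix.mulVec, dotProduct]
    exact analyticAt_const.mul
      (Finset.analyticAt_fun_sum _ fun j _ => (hNa i j).mul analyticAt_const)
  · simp only [Pi.smul_apply, smul_eq_mul, Matrix.vecMul, dotProduct]
    exact analyticAt_const.mul
      (Finset.analyticAt_fun_sum _ fun j _ => analyticAt_const.mul (hNa j i))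
  · simp only [hN, hU.apply_zero, one_smul, h.adjugate_mulVec_one, smul_smul, inv_mul_cancel₀ hc]
  · simp only [hN, hU.apply_zero, one_smul, h.vecMul_adjugate, smul_smul, inv_mul_cancel₀ hc]
  · filter_upwards [hU.det_eq_zero] with z hz
    have h1 := Matrix.mul_adjugate (U z • (1 : Matrix ι ι ℂ) - R.twist z)
    have h2 := Matrix.adjugate_mul (U z • (1 : Matrix ι ι ℂ) - R.twist z)
    rw [hz, zero_smul] at h1 h2
    rw [sub_mul, sub_eq_zero, smul_mul_assoc, one_mul] at h1
    rw [mul_sub, sub_eq_zero, mul_smul_comm, mul_one] at h2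
    constructor
    · rw [Matrix.mulVec_smul, Matrix.mulVec_mulVec, ← h1, Matrix.smul_mulVec, smul_comm]
    · rw [Matrix.smul_vecMul, Matrix.vecMul_vecMul, ← h2, Matrix.vecMul_smul, smul_comm]

open scoped Matrix.Norms.Operator in
/-- Near `0` the powers of `A e^z + B` are `U z ^ n • Q z` up to a small error, uniformly. -/
theorem exists_spectral_projection (h : R.IsStochastic p) {U : ℂ → ℂ} (hU : R.IsBranch U) :
    ∃ Q : ℂ → Matrix ι ι ℂ, (∀ i j, AnalyticAt ℂ (fun z => Q z i j) 0) ∧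
      Q 0 = stationaryMatrix p ∧ ∃ C : ℝ, ∀ᶠ z in nhds (0 : ℂ), ∀ n : ℕ, 0 < n →
        n * ‖R.twist z ^ n - U z ^ n • Q z‖ ≤ C := by
  have := h.nonempty
  obtain ⟨v, w, hva, hwa, hv0, hw0, hvw⟩ := h.exists_eigenvectors hU
  have hda : AnalyticAt ℂ (fun z => w z ⬝ᵥ v z) 0 :=
    Finset.analyticAt_fun_sum _ fun i _ => (hwa i).mul (hva i)
  have hd0 : w 0 ⬝ᵥ v 0 = 1 := by
    simp [hv0, hw0, dotProduct, h.complex_total]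
  set Q : ℂ → Matrix ι ι ℂ := fun z => (w z ⬝ᵥ v z)⁻¹ • Matrix.vecMulVec (v z) (w z) with hQ
  have hQa : ∀ i j, AnalyticAt ℂ (fun z => Q z i j) 0 := fun i j => by
    simp only [hQ, Matrix.smul_apply, Matrix.vecMulVec_apply, smul_eq_mul]
    exact (hda.inv (by rw [hd0]; exact one_ne_zero)).mul ((hva i).mul (hwa j))
  have hQ0 : Q 0 = stationaryMatrix p := by
    ext i j
    simp only [hQ, hd0]
    simp [hv0, hw0, stationaryMatrix]
  refine ⟨Q, hQa, hQ0, ?_⟩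
  obtain ⟨L, hL, hLnorm⟩ := h.exists_pow_norm_lt_one
  obtain ⟨r, hr1, hr2⟩ := exists_between hLnorm
  have hcont : ContinuousAt (fun z => R.twist z - U z • Q z) 0 := by
    refine R.continuous_twist.continuousAt.sub (hU.analyticAt.continuousAt.smul ?_)
    exact continuousAt_pi.2 fun i => continuousAt_pi.2 fun j => (hQa i j).continuousAt
  have hX0 : R.twist 0 - U 0 • Q 0 = R.twist 0 - stationaryMatrix p := by
    rw [hU.apply_zero, one_smul, hQ0]
  set K := ‖R.twist 0 - U 0 • Q 0‖ + 1 with hK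
  refine ⟨L * K ^ L * (1 - r)⁻¹, ?_⟩
  have hev1 : ∀ᶠ z in nhds (0 : ℂ), ‖(R.twist z - U z • Q z) ^ L‖ < r :=
    ((hcont.pow L).norm).eventually_lt continuousAt_const (by
      rw [Pi.pow_apply, hX0]; exact hr1)
  have hev2 : ∀ᶠ z in nhds (0 : ℂ), ‖R.twist z - U z • Q z‖ < K :=
    hcont.norm.eventually_lt continuousAt_const (lt_add_one _)
  have hev3 : ∀ᶠ z in nhds (0 : ℂ), w z ⬝ᵥ v z ≠ 0 :=
    hda.continuousAt.eventually_ne (by rw [hd0]; exact one_ne_zero)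
  filter_upwards [hev1, hev2, hev3, hvw] with z h1 h2 h3 ⟨h4, h5⟩ n hn
  obtain ⟨m, rfl⟩ : ∃ m, n = m + 1 := ⟨n - 1, by omega⟩
  have hTQ : R.twist z * Q z = U z • Q z := by
    simp only [hQ]
    rw [mul_smul_comm, Matrix.mul_vecMulVec, h4, Matrix.smul_vecMulVec, smul_comm]
  have hQT : Q z * R.twist z = U z • Q z := by
    simp only [hQ]
    rw [smul_mul_assoc, Matrix.vecMulVec_mul, h5, Matrix.vecMulVec_smul, smul_comm]
  have hQQ : Q z * Q z = Q z := by
    simp only [hQ]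
    rw [smul_mul_smul_comm, Matrix.vecMulVec_mul_vecMulVec, Matrix.vecMulVec_smul,
      smul_smul]
    congr 1
    field_simp
  rw [← sub_smul_pow_of_absorbing hTQ hQT hQQ]
  exact natCast_mul_norm_pow_le hL ((norm_nonneg _).trans hr1.le) hr2
    (by rw [hK]; linarith [norm_nonneg (R.twist 0 - U 0 • Q 0)]) h1.le h2.le _

end IsStochastic

end LinearRepresentation

theorem AnalyticAt.hasDerivAt_deriv {F : Type*} [NormedAddCommGroup F] [NormedSpace ℂ F]
    [CompleteSpace F] {f : ℂ → F} {x : ℂ} (hf : AnalyticAt ℂ f x) :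
    ∀ᶠ z in nhds x, HasDerivAt f (deriv f z) z :=
  hf.eventually_analyticAt.mono fun _ hz => hz.differentiableAt.hasDerivAt

namespace LinearRepresentation

variable {ι : Type*}

theorem IsWalk.append {R : LinearRepresentation ι} {i j k : ι} {w w' : List Letter}
    (h : R.IsWalk i w j) (h' : R.IsWalk j w' k) : R.IsWalk i (w ++ w') k := by
  induction h with
  | nil => exact h'
  | cons hl _ ih => exact IsWalk.cons hl (ih h')

/-- If the letter weights are a coboundary up to a drift `β`, then so are walk weights. -/
theorem IsWalk.count_eq {R : LinearRepresentation ι} {g : ι → ℝ} {β : ℝ}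
    (ha : ∀ i j, 0 < R.A i j → 1 - β = g i - g j) (hb : ∀ i j, 0 < R.B i j → -β = g i - g j)
    {i j : ι} {w : List Letter} (h : R.IsWalk i w j) :
    (w.count Letter.a : ℝ) = β * w.length + (g i - g j) := by
  induction h with
  | nil => simp
  | @cons i j k l w hl _ ih =>
    cases l with
    | a =>
      have := ha i j hl
      rw [List.count_cons_self, List.length_cons]
      push_cast
      rw [ih]
      linarith
    | b =>
      have := hb i j hl
      rw [List.count_cons_of_ne (by decide), List.length_cons]
      push_cast
      rw [ih]
      linarith

theorem IsAperiodicPair.not_coboundary {R : LinearRepresentation ι} (h : R.IsAperiodicPair)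
    (g : ι → ℝ) (β : ℝ) : ¬ ((∀ i j, 0 < R.A i j → 1 - β = g i - g j) ∧
      ∀ i j, 0 < R.B i j → -β = g i - g j) := by
  rintro ⟨ha, hb⟩
  have h0 : R.period = 0 := by
    rw [period, Nat.setGcd_eq_zero_iff]
    rintro d ⟨w₁, w₂, ⟨i, hi⟩, ⟨j, hj⟩, hlen, rfl⟩
    have h1 := hi.count_eq ha hb
    have h2 := hj.count_eq ha hb
    rw [sub_self, add_zero] at h1 h2
    have h3 : (w₁.count Letter.a : ℝ) = w₂.count Letter.a := by rw [h1, h2, hlen]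
    have h4 : w₁.count Letter.a = w₂.count Letter.a := by exact_mod_cast h3
    simp [h4]
  rw [IsAperiodicPair, h0] at h
  exact zero_ne_one h

variable [Fintype ι] [DecidableEq ι]

namespace IsStochastic

variable {R : LinearRepresentation ι} {p : ι → ℝ}

/-- The first two derivatives at `0` of the eigenvalue equation `T(z) v(z) = U(z) v(z)`. -/
theorem exists_derivative_identities (h : R.IsStochastic p) {U : ℂ → ℂ} (hU : R.IsBranch U) :
    ∃ x y : ι → ℂ, (∀ i, ∑ j, (R.A i j : ℂ) + ∑ j, (R.M i j : ℂ) * x j = deriv U 0 + x i) ∧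
      ∀ i, ∑ j, (R.A i j : ℂ) + 2 * ∑ j, (R.A i j : ℂ) * x j + ∑ j, (R.M i j : ℂ) * y j =
        deriv (deriv U) 0 + 2 * (deriv U 0 * x i) + y i := by
  obtain ⟨v, w, hva, -, hv0, -, hvw⟩ := h.exists_eigenvectors hU
  set v' : ℂ → ι → ℂ := fun z i => deriv (v · i) z with hv'
  have hva' : ∀ i, AnalyticAt ℂ (v' · i) 0 := fun i => (hva i).deriv
  have heq : ∀ i, ∀ᶠ z in nhds (0 : ℂ),
      ∑ j, (Complex.exp z * R.A i j + R.B i j) * v z j = U z * v z i := fun i => by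
    filter_upwards [hvw] with z hz
    simpa [Matrix.mulVec, dotProduct, twist] using congrFun hz.1 i
  have hdv : ∀ᶠ z in nhds (0 : ℂ), ∀ i, HasDerivAt (v · i) (v' z i) z :=
    Filter.eventually_all.2 fun i => (hva i).hasDerivAt_deriv
  have hexp : ∀ (i j : ι) (z : ℂ), HasDerivAt (fun z => Complex.exp z * R.A i j + R.B i j)
      (Complex.exp z * R.A i j) z := fun i j z =>
    ((Complex.hasDerivAt_exp z).mul_const _).add_const _
  have heq' : ∀ i, ∀ᶠ z in nhds (0 : ℂ),
      ∑ j, (Complex.exp z * R.A i j * v z j + (Complex.exp z * R.A i j + R.B i j) * v' z j) =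
        deriv U z * v z i + U z * v' z i := fun i => by
    filter_upwards [(heq i).eventually_nhds, hdv, hU.analyticAt.hasDerivAt_deriv] with z h1 h2 h3
    have h4 := HasDerivAt.fun_sum (u := Finset.univ) fun j _ => (hexp i j z).mul (h2 j)
    exact (h4.congr_of_eventuallyEq (h1.mono fun _ hz => hz.symm)).unique (h3.mul (h2 i))
  have hA : ∀ i j, ((R.A i j : ℂ) + R.B i j) = R.M i j := fun i j => by simp [M]
  refine ⟨v' 0, fun i => deriv (v' · i) 0, fun i => ?_, fun i => ?_⟩
  · have := (heq' i).self_of_nhds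
    simpa [hv0, hU.apply_zero, Finset.sum_add_distrib, hA] using this
  · have h2 := hdv.self_of_nhds
    have h3 := hU.analyticAt.hasDerivAt_deriv.self_of_nhds
    have h4 := hU.analyticAt.deriv.hasDerivAt_deriv.self_of_nhds
    have h5 : ∀ j, HasDerivAt (v' · j) (deriv (v' · j) 0) 0 :=
      fun j => (hva' j).hasDerivAt_deriv.self_of_nhds
    have hexp' : ∀ j, HasDerivAt (fun z => Complex.exp z * R.A i j) (Complex.exp 0 * R.A i j) 0 :=
      fun j => (Complex.hasDerivAt_exp 0).mul_const _
    have h6 := HasDerivAt.fun_sum (u := Finset.univ) fun j _ =>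
      ((hexp' j).mul (h2 j)).add ((hexp i j 0).mul (h5 j))
    have h7 := (h6.congr_of_eventuallyEq ((heq' i).mono fun _ hz => hz.symm)).unique
      ((h4.mul (h2 i)).add (h3.mul (h5 i)))
    simp only [hv0, hU.apply_zero, Complex.exp_zero, one_mul, Pi.one_apply, mul_one, hA,
      Finset.sum_add_distrib] at h7
    linear_combination h7

theorem sum_mul_sum (h : R.IsStochastic p) (y : ι → ℂ) :
    ∑ i, (p i : ℂ) * ∑ j, (R.M i j : ℂ) * y j = ∑ j, (p j : ℂ) * y j := by
  simp only [Finset.mul_sum]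
  rw [Finset.sum_comm]
  refine Finset.sum_congr rfl fun j _ => ?_
  have := congrArg ((↑) : ℝ → ℂ) (congrFun h.stationary j)
  simp only [Matrix.vecMul, dotProduct, Complex.ofReal_sum, Complex.ofReal_mul] at this
  rw [← this, Finset.sum_mul]
  exact Finset.sum_congr rfl fun i _ => by ring

theorem sum_mul_sum_real (h : R.IsStochastic p) (y : ι → ℝ) :
    ∑ i, p i * ∑ j, R.M i j * y j = ∑ j, p j * y j := by
  exact_mod_cast h.sum_mul_sum fun j => (y j : ℂ)

/-- Real versions of the derivative identities, with the corrector `g`. -/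
theorem exists_corrector (h : R.IsStochastic p) {U : ℂ → ℂ} (hU : R.IsBranch U) :
    ∃ g : ι → ℝ, ∃ β δ : ℝ, deriv U 0 = β ∧ deriv (deriv U) 0 = δ ∧
      (∀ i, ∑ j, R.A i j + ∑ j, R.M i j * g j = β + g i) ∧
      β = ∑ i, p i * ∑ j, R.A i j ∧
      δ = ∑ i, p i * ∑ j, R.A i j + 2 * ∑ i, p i * ∑ j, R.A i j * g j
        - 2 * (β * ∑ i, p i * g i) := by
  obtain ⟨x, y, h1, h2⟩ := h.exists_derivative_identities hU
  have hβ : deriv U 0 = ((∑ i, p i * ∑ j, R.A i j : ℝ) : ℂ) := by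
    have := Finset.sum_congr (rfl : Finset.univ = Finset.univ)
      fun i _ => congrArg ((p i : ℂ) * ·) (h1 i)
    simp only [mul_add, Finset.sum_add_distrib, h.sum_mul_sum, ← Finset.sum_mul,
      h.complex_total, one_mul] at this
    push_cast
    linear_combination -this
  set β : ℝ := ∑ i, p i * ∑ j, R.A i j with hβdef
  have hδ : deriv (deriv U) 0 = ∑ i, (p i : ℂ) * ∑ j, (R.A i j : ℂ)
      + 2 * ∑ i, (p i : ℂ) * ∑ j, (R.A i j : ℂ) * x j - 2 * (β * ∑ i, (p i : ℂ) * x i) := by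
    have h3 : ∀ i, (p i : ℂ) * ∑ j, (R.A i j : ℂ) + 2 * ((p i : ℂ) * ∑ j, (R.A i j : ℂ) * x j)
        + (p i : ℂ) * ∑ j, (R.M i j : ℂ) * y j =
        deriv (deriv U) 0 * (p i : ℂ) + 2 * (β * ((p i : ℂ) * x i)) + (p i : ℂ) * y i := fun i => by
      rw [← hβ]
      linear_combination (p i : ℂ) * h2 i
    have := Finset.sum_congr (rfl : Finset.univ = Finset.univ) fun i _ => h3 i
    simp only [Finset.sum_add_distrib, h.sum_mul_sum, ← Finset.mul_sum, h.complex_total] at this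
    linear_combination -this
  have him : ∃ c : ℝ, ∀ i, (x i).im = c := by
    have h3 : R.twist 0 *ᵥ (fun i => ((x i).im : ℂ)) = fun i => ((x i).im : ℂ) := by
      ext i
      have h4 := congrArg Complex.im (h1 i)
      simp only [hβ, Complex.add_im, Complex.im_sum, Complex.ofReal_im, Finset.sum_const_zero,
        Complex.im_ofReal_mul, zero_add] at h4
      simp only [twist_zero, Matrix.mulVec, dotProduct, Matrix.map_apply]
      exact_mod_cast h4
    have h5 := h.eq_smul_one_of_twist_zero_mulVec h3
    refine ⟨∑ i, p i * (x i).im, fun i => ?_⟩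
    have h6 := congrFun h5 i
    simp only [dotProduct, Pi.smul_apply, Pi.one_apply, smul_eq_mul, mul_one] at h6
    exact_mod_cast h6
  obtain ⟨c, hc⟩ := him
  refine ⟨fun i => (x i).re, β, _, hβ, ?_, fun i => ?_, hβdef, rfl⟩
  · apply Complex.ext
    · rw [hδ]
      simp [Complex.re_sum, Complex.im_sum]
      exact hβdef.symm
    · rw [hδ, Complex.ofReal_im]
      have h7 : ∑ i, p i * ∑ j, R.A i j * (x j).im = β * c := by
        simp only [hc, ← Finset.sum_mul, hβdef, ← mul_assoc]
      have h8 : ∑ i, p i * (x i).im = c := by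
        simp only [hc, ← Finset.sum_mul, h.total, one_mul]
      simp [Complex.re_sum, Complex.im_sum, h7, h8]
  · have h4 := congrArg Complex.re (h1 i)
    simpa [hβ, Complex.re_sum, Complex.re_ofReal_mul] using h4

theorem variance_eq (h : R.IsStochastic p) {g : ι → ℝ} {β : ℝ}
    (hg : ∀ i, ∑ j, R.A i j + ∑ j, R.M i j * g j = β + g i)
    (hβ : β = ∑ i, p i * ∑ j, R.A i j) :
    ∑ i, p i * ∑ j, (R.A i j * (1 - β + (g j - g i)) ^ 2 + R.B i j * (-β + (g j - g i)) ^ 2) =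
      ∑ i, p i * ∑ j, R.A i j + 2 * ∑ i, p i * ∑ j, R.A i j * g j
        - 2 * (β * ∑ i, p i * g i) - β ^ 2 := by
  have hrow : ∀ i, ∑ j, R.M i j = 1 := fun i => by
    simpa [Matrix.mulVec, dotProduct] using congrFun h.row_sum i
  have hterm : ∀ i, ∑ j, (R.A i j * (1 - β + (g j - g i)) ^ 2
      + R.B i j * (-β + (g j - g i)) ^ 2) =
      ∑ j, R.M i j * g j ^ 2 - g i ^ 2 + β ^ 2 + (1 - 2 * β) * ∑ j, R.A i j
        + 2 * ∑ j, R.A i j * g j - 2 * (∑ j, R.M i j * g j - g i) * β - 2 * (β * g i) := fun i => by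
    have h1 : ∀ j, R.A i j * (1 - β + (g j - g i)) ^ 2 + R.B i j * (-β + (g j - g i)) ^ 2 =
        R.M i j * g j ^ 2 - 2 * (g i + β) * (R.M i j * g j)
          + (g i + β) ^ 2 * R.M i j + (1 - 2 * β - 2 * g i) * R.A i j
          + 2 * (R.A i j * g j) := fun j => by
      simp only [M, Matrix.add_apply]
      ring
    simp only [h1, Finset.sum_add_distrib, Finset.sum_sub_distrib, ← Finset.mul_sum, hrow]
    linear_combination (-2 * g i) * hg i
  have hterm' : ∀ i, p i * ∑ j, (R.A i j * (1 - β + (g j - g i)) ^ 2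
      + R.B i j * (-β + (g j - g i)) ^ 2) =
      p i * ∑ j, R.M i j * g j ^ 2 - p i * g i ^ 2 + β ^ 2 * p i
        + (1 - 2 * β) * (p i * ∑ j, R.A i j) + 2 * (p i * ∑ j, R.A i j * g j)
        - 2 * β * (p i * ∑ j, R.M i j * g j) := fun i => by
    rw [hterm]
    ring
  rw [Finset.sum_congr rfl fun i _ => hterm' i]
  simp only [Finset.sum_add_distrib, Finset.sum_sub_distrib, ← Finset.mul_sum,
    h.sum_mul_sum_real, h.total, ← hβ]
  ring

/-- The asymptotic variance is positive for aperiodic pairs. -/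
theorem variance_pos (h : R.IsStochastic p) (hap : R.IsAperiodicPair) {U : ℂ → ℂ}
    (hU : R.IsBranch U) :
    ∃ β γ : ℝ, 0 < γ ∧ deriv U 0 = β ∧ deriv (deriv U) 0 = ((γ + β ^ 2 : ℝ) : ℂ) := by
  obtain ⟨g, β, δ, h1, h2, h3, h4, h5⟩ := h.exists_corrector hU
  refine ⟨β, δ - β ^ 2, ?_, h1, by rw [h2]; simp⟩
  rw [h5, ← h.variance_eq h3 h4]
  have hnn : ∀ i j, 0 ≤ R.A i j * (1 - β + (g j - g i)) ^ 2 + R.B i j * (-β + (g j - g i)) ^ 2 :=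
    fun i j => add_nonneg (mul_nonneg (R.A_nonneg i j) (sq_nonneg _))
      (mul_nonneg (R.B_nonneg i j) (sq_nonneg _))
  have hnn' := fun i => mul_nonneg (h.pos i).le
    (Finset.sum_nonneg fun j (_ : j ∈ Finset.univ) => hnn i j)
  refine lt_of_le_of_ne (Finset.sum_nonneg fun i _ => hnn' i) fun h0 => ?_
  have hz : ∀ i j, R.A i j * (1 - β + (g j - g i)) ^ 2 + R.B i j * (-β + (g j - g i)) ^ 2 = 0 :=
    fun i j => by
      have h6 := (Finset.sum_eq_zero_iff_of_nonneg fun i _ => hnn' i).1 h0.symm i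
        (Finset.mem_univ i)
      have h7 := (mul_eq_zero.1 h6).resolve_left (h.pos i).ne'
      exact (Finset.sum_eq_zero_iff_of_nonneg fun j _ => hnn i j).1 h7 j (Finset.mem_univ j)
  refine hap.not_coboundary g β ⟨fun i j hA => ?_, fun i j hB => ?_⟩
  · have h6 := mul_nonneg (R.B_nonneg i j) (sq_nonneg (-β + (g j - g i)))
    have h7 := mul_nonneg hA.le (sq_nonneg (1 - β + (g j - g i)))
    have h8 : R.A i j * (1 - β + (g j - g i)) ^ 2 = 0 := by linarith [hz i j]
    have h9 := pow_eq_zero_iff two_ne_zero |>.1 ((mul_eq_zero.1 h8).resolve_left hA.ne')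
    linarith
  · have h6 := mul_nonneg hB.le (sq_nonneg (-β + (g j - g i)))
    have h7 := mul_nonneg (R.A_nonneg i j) (sq_nonneg (1 - β + (g j - g i)))
    have h8 : R.B i j * (-β + (g j - g i)) ^ 2 = 0 := by linarith [hz i j]
    have h9 := pow_eq_zero_iff two_ne_zero |>.1 ((mul_eq_zero.1 h8).resolve_left hB.ne')
    linarith

end IsStochastic

/-- Second order expansion of the logarithm of an analytic function. -/
theorem exists_log_expansion {U : ℂ → ℂ} (hU : AnalyticAt ℂ U 0) (hU0 : U 0 = 1) {b c : ℂ}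
    (hb : deriv U 0 = b) (hc : deriv (deriv U) 0 = c + b ^ 2) :
    ∃ C : ℝ, ∀ᶠ z in nhds (0 : ℂ), ∃ e : ℂ, ‖e‖ ≤ C * ‖z‖ ^ 3 ∧
      U z = Complex.exp (b * z + c / 2 * z ^ 2 + e) := by
  have hlog : AnalyticAt ℂ (fun z => Complex.log (U z)) 0 :=
    hU.clog (by rw [hU0]; exact Complex.one_mem_slitPlane)
  set f : ℂ → ℂ := fun z => Complex.log (U z) - (b * z + c / 2 * z ^ 2) with hf
  have hfa : AnalyticAt ℂ f 0 := hlog.sub (by fun_prop)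
  have hne : ∀ᶠ z in nhds (0 : ℂ), U z ∈ Complex.slitPlane :=
    hU.continuousAt.eventually_mem
      (Complex.isOpen_slitPlane.mem_nhds (by rw [hU0]; exact Complex.one_mem_slitPlane))
  have hquad : ∀ z : ℂ, HasDerivAt (fun z : ℂ => b * z + c / 2 * z ^ 2) (b + c * z) z := fun z => by
    have h1 := ((hasDerivAt_id z).const_mul b).add (((hasDerivAt_id z).pow 2).const_mul (c / 2))
    refine h1.congr_deriv ?_
    simp
    ring
  have hf1 : ∀ᶠ z in nhds (0 : ℂ), HasDerivAt f (deriv U z / U z - (b + c * z)) z := by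
    filter_upwards [hne, hU.hasDerivAt_deriv] with z h1 h2
    exact (h2.clog h1).sub (hquad z)
  have hf2 : HasDerivAt (fun z => deriv U z / U z - (b + c * z)) 0 0 := by
    have h1 := hU.hasDerivAt_deriv.self_of_nhds
    have h2 := hU.deriv.hasDerivAt_deriv.self_of_nhds
    have h3 := (h2.div h1 (by rw [hU0]; exact one_ne_zero)).sub
      (((hasDerivAt_id (0 : ℂ)).const_mul c).const_add b)
    refine h3.congr_deriv ?_
    rw [hU0, hb, hc]
    ring
  have hd1 : deriv f =ᶠ[nhds 0] fun z => deriv U z / U z - (b + c * z) :=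
    hf1.mono fun _ h => h.deriv
  have horder : ((3 : ℕ) : ℕ∞) ≤ analyticOrderAt f 0 := by
    rw [natCast_le_analyticOrderAt_iff_iteratedDeriv_eq_zero hfa]
    intro i hi
    interval_cases i
    · simp [hf, hU0]
    · rw [iteratedDeriv_one, hd1.self_of_nhds]
      simp [hU0, hb]
    · rw [iteratedDeriv_succ, iteratedDeriv_one, hd1.deriv_eq, hf2.deriv]
  obtain ⟨q, hq, hfq⟩ := (natCast_le_analyticOrderAt hfa).1 horder
  refine ⟨‖q 0‖ + 1, ?_⟩
  filter_upwards [hfq, hne, hq.continuousAt.norm.eventually_lt continuousAt_const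
    (lt_add_one ‖q 0‖)] with z h1 h2 h3
  refine ⟨f z, ?_, ?_⟩
  · rw [h1, sub_zero, norm_smul, norm_pow, mul_comm]
    exact mul_le_mul_of_nonneg_right h3.le (by positivity)
  · rw [hf]
    simp only [add_sub_cancel]
    exact (Complex.exp_log (Complex.slitPlane_ne_zero h2)).symm

end LinearRepresentation

/-- Equality case of the triangle inequality for positive combinations of unit complex numbers. -/
theorem eq_of_sum_le_norm_sum {κ : Type*} {s : Finset κ} {a : κ → ℝ} {u : κ → ℂ}
    (ha : ∀ k ∈ s, 0 ≤ a k) (hu : ∀ k ∈ s, ‖u k‖ = 1)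
    (hle : ∑ k ∈ s, a k ≤ ‖∑ k ∈ s, (a k : ℂ) * u k‖) {k l : κ} (hk : k ∈ s) (hl : l ∈ s)
    (hak : 0 < a k) (hal : 0 < a l) : u k = u l := by
  set S := ∑ k ∈ s, (a k : ℂ) * u k with hS
  have hSpos : 0 < ‖S‖ := (Finset.sum_pos' ha ⟨k, hk, hak⟩).trans_le hle
  set c : ℂ := (starRingEnd ℂ) S / ‖S‖ with hc
  have hcn : ‖c‖ = 1 := by
    rw [hc, norm_div, RCLike.norm_conj, Complex.norm_real, norm_norm, div_self hSpos.ne']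
  have hcS : c * S = ‖S‖ := by
    rw [hc, div_mul_eq_mul_div, mul_comm, Complex.mul_conj, Complex.normSq_eq_norm_sq]
    have : (‖S‖ : ℂ) ≠ 0 := by exact_mod_cast hSpos.ne'
    push_cast
    field_simp
  have hre : ∀ k ∈ s, (c * u k).re ≤ 1 := fun k hk =>
    (Complex.re_le_norm _).trans (by rw [norm_mul, hcn, hu k hk, one_mul])
  have hsum : ∑ k ∈ s, a k * (1 - (c * u k).re) ≤ 0 := by
    have h1 : ∑ k ∈ s, a k * (c * u k).re = ‖S‖ := by
      have h2 := congrArg Complex.re hcS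
      rw [hS, Finset.mul_sum, Complex.re_sum, Complex.ofReal_re] at h2
      rw [← h2]
      refine Finset.sum_congr rfl fun k _ => ?_
      rw [mul_left_comm, Complex.re_ofReal_mul]
    simp only [mul_sub, mul_one, Finset.sum_sub_distrib, h1]
    linarith
  have hnn : ∀ k ∈ s, 0 ≤ a k * (1 - (c * u k).re) := fun k hk =>
    mul_nonneg (ha k hk) (sub_nonneg.2 (hre k hk))
  have hone : ∀ m ∈ s, 0 < a m → c * u m = 1 := fun m hm ham => by
    have h1 := (Finset.sum_eq_zero_iff_of_nonneg hnn).1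
      (le_antisymm hsum (Finset.sum_nonneg hnn)) m hm
    have h2 : (c * u m).re = 1 := by
      linarith [(mul_eq_zero.1 h1).resolve_left ham.ne']
    have h3 : ‖c * u m‖ = 1 := by rw [norm_mul, hcn, hu m hm, one_mul]
    have h4 := Complex.sq_norm_sub_sq_re (c * u m)
    rw [h3, h2, sub_self] at h4
    exact Complex.ext h2 (by simpa using pow_eq_zero_iff two_ne_zero |>.1 h4.symm)
  have hc0 : c ≠ 0 := norm_pos_iff.1 (by rw [hcn]; exact one_pos)
  exact mul_left_cancel₀ hc0 ((hone k hk hak).trans (hone l hl hal).symm)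

namespace LinearRepresentation

variable {ι : Type*} [Fintype ι] [DecidableEq ι]

theorem letterMatrix_nonneg (R : LinearRepresentation ι) (l : Letter) (i j : ι) :
    0 ≤ R.letterMatrix l i j := by
  cases l
  exacts [R.A_nonneg i j, R.B_nonneg i j]

theorem μ_nil (R : LinearRepresentation ι) : R.μ [] = 1 := rfl

theorem μ_cons (R : LinearRepresentation ι) (l : Letter) (w : List Letter) :
    R.μ (l :: w) = R.letterMatrix l * R.μ w := by
  simp [μ]

theorem μ_nonneg (R : LinearRepresentation ι) (w : List Letter) (i j : ι) : 0 ≤ R.μ w i j := by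
  induction w generalizing i with
  | nil => rw [μ_nil, Matrix.one_apply]; split_ifs <;> norm_num
  | cons l w ih =>
    rw [μ_cons, Matrix.mul_apply]
    exact Finset.sum_nonneg fun k _ => mul_nonneg (R.letterMatrix_nonneg l i k) (ih k)

theorem μ_pos_iff (R : LinearRepresentation ι) (w : List Letter) (i j : ι) :
    0 < R.μ w i j ↔ R.IsWalk i w j := by
  constructor
  · induction w generalizing i with
    | nil =>
      intro h
      rw [μ_nil, Matrix.one_apply] at h
      split_ifs at h with hij
      · exact hij ▸ IsWalk.nil i
      · exact absurd h (lt_irrefl _)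
    | cons l w ih =>
      intro h
      rw [μ_cons, Matrix.mul_apply] at h
      obtain ⟨k, -, hk⟩ := Finset.exists_lt_of_sum_lt (f := fun _ : ι => (0 : ℝ)) (by simpa using h)
      have h1 := R.letterMatrix_nonneg l i k
      have h2 := R.μ_nonneg w k j
      exact IsWalk.cons (lt_of_le_of_ne h1 fun h => by simp [← h] at hk)
        (ih k (lt_of_le_of_ne h2 fun h => by simp [← h] at hk))
  · intro h
    induction h with
    | nil i => simp [μ_nil]
    | @cons i j k l w hl _ ih =>
      rw [μ_cons, Matrix.mul_apply]
      exact Finset.sum_pos' (fun m _ => mul_nonneg (R.letterMatrix_nonneg l i m)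
        (R.μ_nonneg w m k)) ⟨j, Finset.mem_univ _, mul_pos hl ih⟩

theorem sum_letter {V : Type*} [AddCommMonoid V] (f : Letter → V) :
    ∑ l, f l = f Letter.a + f Letter.b := by
  have : (Finset.univ : Finset Letter) = {Letter.a, Letter.b} := rfl
  rw [this, Finset.sum_pair (by decide)]

theorem twist_eq_sum (R : LinearRepresentation ι) (z : ℂ) :
    R.twist z = ∑ l, Complex.exp (z * ([l].count Letter.a : ℕ)) •
      (R.letterMatrix l).map ((↑) : ℝ → ℂ) := by
  rw [sum_letter]
  simp [twist, letterMatrix]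

theorem twist_pow_eq_sum (R : LinearRepresentation ι) (z : ℂ) (n : ℕ) :
    R.twist z ^ n = ∑ w : Fin n → Letter,
      Complex.exp (z * ((List.ofFn w).count Letter.a : ℕ)) •
        (R.μ (List.ofFn w)).map ((↑) : ℝ → ℂ) := by
  induction n with
  | zero =>
    ext i j
    simp [μ_nil, Matrix.one_apply]
  | succ n ih =>
    rw [pow_succ', ih, twist_eq_sum, Finset.sum_mul_sum,
      ← (Fin.consEquiv fun _ : Fin (n + 1) => Letter).sum_comp, Fintype.sum_prod_type]
    refine Finset.sum_congr rfl fun l _ => Finset.sum_congr rfl fun w _ => ?_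
    have h1 : List.ofFn (Fin.consEquiv (fun _ : Fin (n + 1) => Letter) (l, w)) =
        l :: List.ofFn w := by
      simp [List.ofFn_succ, Fin.consEquiv]
    have h2 : (R.letterMatrix l * R.μ (List.ofFn w)).map ((↑) : ℝ → ℂ) =
        (R.letterMatrix l).map ((↑) : ℝ → ℂ) * (R.μ (List.ofFn w)).map ((↑) : ℝ → ℂ) :=
      Matrix.map_mul (f := Complex.ofRealHom)
    rw [h1, μ_cons, h2, smul_mul_smul_comm, ← Complex.exp_add, ← mul_add,
      ← Nat.cast_add, ← List.count_append, List.singleton_append]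

theorem M_pow_eq_sum (R : LinearRepresentation ι) (n : ℕ) :
    R.M ^ n = ∑ w : Fin n → Letter, R.μ (List.ofFn w) := by
  have h1 := R.twist_pow_eq_sum 0 n
  rw [twist_zero, show R.M.map ((↑) : ℝ → ℂ) ^ n = (R.M ^ n).map ((↑) : ℝ → ℂ) from
    (Matrix.map_pow R.M Complex.ofRealHom n).symm] at h1
  ext i j
  have h2 := congrFun (congrFun h1 i) j
  simp only [zero_mul, Complex.exp_zero, one_smul, Matrix.map_apply, Matrix.sum_apply] at h2
  rw [Matrix.sum_apply]
  exact_mod_cast h2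

theorem exists_isWalk (R : LinearRepresentation ι) (hR : R.M.IsPrimitive) (i j : ι) :
    ∃ w, R.IsWalk i w j := by
  obtain ⟨k, -, hk⟩ := hR.exists_pos_pow
  have h := hk i j
  rw [M_pow_eq_sum, Matrix.sum_apply] at h
  obtain ⟨w, -, hw⟩ := Finset.exists_lt_of_sum_lt (f := fun _ : Fin k → Letter => (0 : ℝ))
    (by simpa using h)
  exact ⟨_, (R.μ_pos_iff _ i j).1 hw⟩

theorem norm_exp_mul_I_mul_natCast (θ : ℝ) (n : ℕ) :
    ‖Complex.exp (θ * Complex.I * n)‖ = 1 := by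
  rw [mul_right_comm, ← Complex.ofReal_natCast, ← Complex.ofReal_mul,
    Complex.norm_exp_ofReal_mul_I]

theorem norm_twist_pow_apply_le (R : LinearRepresentation ι) (θ : ℝ) (n : ℕ) (i j : ι) :
    ‖(R.twist (θ * Complex.I) ^ n) i j‖ ≤ (R.M ^ n) i j := by
  rw [twist_pow_eq_sum, M_pow_eq_sum, Matrix.sum_apply, Matrix.sum_apply]
  refine (norm_sum_le _ _).trans (Finset.sum_le_sum fun w _ => ?_)
  rw [Matrix.smul_apply, smul_eq_mul, norm_mul, norm_exp_mul_I_mul_natCast, one_mul,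
    Matrix.map_apply, Complex.norm_real, Real.norm_of_nonneg (R.μ_nonneg _ i j)]

/-- If the entry of a twisted power has full modulus, walks of the same length with the same
endpoints have the same phase. -/
theorem exp_count_eq_of_le_norm {R : LinearRepresentation ι} {θ : ℝ} {i j : ι}
    {w w' : List Letter} (hlen : w.length = w'.length)
    (hle : (R.M ^ w.length) i j ≤ ‖(R.twist (θ * Complex.I) ^ w.length) i j‖)
    (hw : R.IsWalk i w j) (hw' : R.IsWalk i w' j) :
    Complex.exp (θ * Complex.I * (w.count Letter.a : ℕ)) =
      Complex.exp (θ * Complex.I * (w'.count Letter.a : ℕ)) := by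
  obtain ⟨n, x, rfl⟩ : ∃ n, ∃ x : Fin n → Letter, w = List.ofFn x :=
    ⟨_, w.get, (List.ofFn_get w).symm⟩
  rw [List.length_ofFn] at hle hlen
  obtain ⟨y, rfl⟩ : ∃ y : Fin n → Letter, w' = List.ofFn y := by
    subst hlen
    exact ⟨w'.get, (List.ofFn_get w').symm⟩
  rw [M_pow_eq_sum, twist_pow_eq_sum, Matrix.sum_apply, Matrix.sum_apply] at hle
  simp only [Matrix.smul_apply, Matrix.map_apply, smul_eq_mul, mul_comm (Complex.exp _)] at hle
  exact eq_of_sum_le_norm_sum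
    (u := fun x : Fin n → Letter =>
      Complex.exp (θ * Complex.I * ((List.ofFn x).count Letter.a : ℕ)))
    (fun x _ => R.μ_nonneg (List.ofFn x) i j) (fun x _ => norm_exp_mul_I_mul_natCast θ _) hle
    (Finset.mem_univ x) (Finset.mem_univ y) ((R.μ_pos_iff _ i j).2 hw) ((R.μ_pos_iff _ i j).2 hw')

/-- For an aperiodic pair, every row of some power of the twisted matrix loses mass. -/
theorem IsAperiodicPair.exists_norm_lt {R : LinearRepresentation ι} (hap : R.IsAperiodicPair)
    (hR : R.M.IsPrimitive) {θ : ℝ} (h0 : θ ≠ 0) (hπ : |θ| ≤ Real.pi) (i₀ : ι) :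
    ∃ n j, ‖(R.twist (θ * Complex.I) ^ n) i₀ j‖ < (R.M ^ n) i₀ j := by
  by_contra! hcon
  set ω := Complex.exp (θ * Complex.I) with hω
  have hωpow : ∀ n : ℕ, Complex.exp (θ * Complex.I * n) = ω ^ n := fun n => by
    rw [mul_comm, Complex.exp_nat_mul]
  have hω0 : ω ≠ 0 := Complex.exp_ne_zero _
  have hcyc : ∀ w₁ w₂ : List Letter, R.IsCycleLabel w₁ → R.IsCycleLabel w₂ →
      w₁.length = w₂.length → ω ^ w₁.count Letter.a = ω ^ w₂.count Letter.a := by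
    rintro w₁ w₂ ⟨i, hi⟩ ⟨j, hj⟩ hlen
    obtain ⟨s, hs⟩ := R.exists_isWalk hR i₀ i
    obtain ⟨t, ht⟩ := R.exists_isWalk hR i j
    have h1 := exp_count_eq_of_le_norm (w := s ++ (w₁ ++ t)) (w' := s ++ (t ++ w₂)) (θ := θ)
      (by simp only [List.length_append]; omega) (hcon _ _) (hs.append (hi.append ht))
      (hs.append (ht.append hj))
    rw [hωpow, hωpow] at h1
    simp only [List.count_append, pow_add] at h1
    have h2 := mul_left_cancel₀ (pow_ne_zero _ hω0) h1
    rw [mul_comm] at h2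
    exact mul_left_cancel₀ (pow_ne_zero _ hω0) h2
  have hdvd : orderOf ω ∣ R.period := by
    rw [period, Nat.dvd_setGcd_iff]
    rintro d ⟨w₁, w₂, h₁, h₂, hlen, rfl⟩
    rw [orderOf_dvd_iff_pow_eq_one]
    have h3 := hcyc w₁ w₂ h₁ h₂ hlen
    rcases le_total (w₁.count Letter.a) (w₂.count Letter.a) with hle | hle
    · obtain ⟨d, hd⟩ := Nat.exists_eq_add_of_le hle
      rw [hd, pow_add] at h3
      have h4 : ω ^ d = 1 :=
        mul_left_cancel₀ (pow_ne_zero (w₁.count Letter.a) hω0) (by rw [mul_one]; exact h3.symm)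
      rw [hd]
      simpa using h4
    · obtain ⟨d, hd⟩ := Nat.exists_eq_add_of_le hle
      rw [hd, pow_add] at h3
      have h4 : ω ^ d = 1 :=
        mul_left_cancel₀ (pow_ne_zero (w₂.count Letter.a) hω0) (by rw [mul_one]; exact h3)
      rw [hd]
      simpa using h4
  rw [show R.period = 1 from hap, Nat.dvd_one, orderOf_eq_one_iff, hω,
    Complex.exp_eq_one_iff] at hdvd
  obtain ⟨m, hm⟩ := hdvd
  have hθ : θ = m * (2 * Real.pi) := by
    have h5 : (θ : ℂ) = ((m * (2 * Real.pi) : ℝ) : ℂ) := by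
      apply mul_right_cancel₀ Complex.I_ne_zero
      rw [hm]
      push_cast
      ring
    exact_mod_cast h5
  have hm0 : m ≠ 0 := by
    rintro rfl
    simp [hθ] at h0
  have hm1 : (1 : ℝ) ≤ |(m : ℝ)| := by exact_mod_cast Int.one_le_abs hm0
  rw [hθ, abs_mul, abs_of_pos Real.two_pi_pos] at hπ
  nlinarith [Real.pi_pos]

namespace IsStochastic

variable {R : LinearRepresentation ι} {p : ι → ℝ}

theorem sum_pow_apply (h : R.IsStochastic p) (n : ℕ) (i : ι) : ∑ j, (R.M ^ n) i j = 1 := by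
  have := congrFun (Matrix.pow_mulVec_of_mulVec_eq_smul (r := (1 : ℝ)) (P := R.M) (x := 1)
    (by rw [h.row_sum, one_smul]) n) i
  simpa [Matrix.mulVec, dotProduct] using this

theorem antitone_row_norm (h : R.IsStochastic p) (θ : ℝ) (i : ι) :
    Antitone fun n => ∑ j, ‖(R.twist (θ * Complex.I) ^ n) i j‖ := by
  refine antitone_nat_of_succ_le fun n => ?_
  calc ∑ j, ‖(R.twist (θ * Complex.I) ^ (n + 1)) i j‖
      ≤ ∑ j, ∑ k, ‖(R.twist (θ * Complex.I) ^ n) i k‖ * ‖R.twist (θ * Complex.I) k j‖ := by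
        refine Finset.sum_le_sum fun j _ => ?_
        rw [pow_succ, Matrix.mul_apply]
        exact (norm_sum_le _ _).trans (Finset.sum_le_sum fun k _ => (norm_mul _ _).le)
    _ = ∑ k, ‖(R.twist (θ * Complex.I) ^ n) i k‖ * ∑ j, ‖R.twist (θ * Complex.I) k j‖ := by
        rw [Finset.sum_comm]
        simp only [Finset.mul_sum]
    _ ≤ ∑ k, ‖(R.twist (θ * Complex.I) ^ n) i k‖ := by
        refine Finset.sum_le_sum fun k _ => mul_le_of_le_one_right (norm_nonneg _) ?_
        have h1 := h.sum_pow_apply 1 k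
        rw [← h1]
        exact Finset.sum_le_sum fun j _ => by
          simpa using R.norm_twist_pow_apply_le θ 1 k j

open scoped Matrix.Norms.Operator

theorem norm_twist_le_one (h : R.IsStochastic p) (θ : ℝ) : ‖R.twist (θ * Complex.I)‖ ≤ 1 := by
  rw [Matrix.linfty_opNorm_le_iff zero_le_one]
  intro i
  rw [← h.sum_pow_apply 1 i]
  exact Finset.sum_le_sum fun j _ => by simpa using R.norm_twist_pow_apply_le θ 1 i j

theorem exists_norm_twist_pow_lt_one (h : R.IsStochastic p) (hap : R.IsAperiodicPair) {θ : ℝ}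
    (h0 : θ ≠ 0) (hπ : |θ| ≤ Real.pi) : ∃ n, ‖R.twist (θ * Complex.I) ^ n‖ < 1 := by
  choose n j hnj using hap.exists_norm_lt h.primitive h0 hπ
  refine ⟨Finset.univ.sup n, ?_⟩
  rw [Matrix.linfty_opNorm_lt_iff one_pos]
  intro i
  refine (h.antitone_row_norm θ i (Finset.le_sup (Finset.mem_univ i))).trans_lt ?_
  rw [← h.sum_pow_apply (n i) i]
  exact Finset.sum_lt_sum (fun k _ => R.norm_twist_pow_apply_le θ (n i) i k)
    ⟨j i, Finset.mem_univ _, hnj i⟩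

/-- Away from `0` the powers of the twisted matrix decay uniformly on the unit circle. -/
theorem exists_decay (h : R.IsStochastic p) (hap : R.IsAperiodicPair) {δ : ℝ} (hδ : 0 < δ) :
    ∃ C : ℝ, ∀ θ : ℝ, δ ≤ |θ| → |θ| ≤ Real.pi → ∀ n : ℕ,
      n * ‖R.twist (θ * Complex.I) ^ n‖ ≤ C := by
  have := h.nonempty
  set S : Set ℝ := {θ | δ ≤ |θ| ∧ |θ| ≤ Real.pi} with hS
  have hScomp : IsCompact S := by
    refine (isCompact_Icc (a := -Real.pi) (b := Real.pi)).of_isClosed_subset ?_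
      fun θ hθ => abs_le.1 hθ.2
    exact (isClosed_le continuous_const continuous_abs).inter
      (isClosed_le continuous_abs continuous_const)
  have hcont : ∀ n : ℕ, Continuous fun θ : ℝ => ‖R.twist (θ * Complex.I) ^ n‖ := fun n => by
    have h1 : Continuous fun θ : ℝ => R.twist (θ * Complex.I) :=
      R.continuous_twist.comp (by fun_prop)
    exact (h1.pow n).norm
  have hanti : ∀ θ : ℝ, Antitone fun n => ‖R.twist (θ * Complex.I) ^ n‖ := fun θ =>
    antitone_nat_of_succ_le fun n => by
      rw [pow_succ]
      exact (norm_mul_le _ _).trans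
        (mul_le_of_le_one_right (norm_nonneg _) (h.norm_twist_le_one θ))
  obtain ⟨L, hL⟩ := hScomp.elim_directed_cover
    (fun n : ℕ => {θ : ℝ | ‖R.twist (θ * Complex.I) ^ (n + 1)‖ < 1})
    (fun n => isOpen_lt (hcont _) continuous_const)
    (fun θ hθ => by
      obtain ⟨n, hn⟩ := h.exists_norm_twist_pow_lt_one hap (θ := θ)
        (by rintro rfl; simp [hS] at hθ; linarith [hθ.1]) hθ.2
      exact Set.mem_iUnion.2 ⟨n, (hanti θ (Nat.le_succ n)).trans_lt hn⟩)
    (directed_of_isDirected_le fun m n hmn θ hθ =>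
      (hanti θ (Nat.succ_le_succ hmn)).trans_lt hθ)
  rcases S.eq_empty_or_nonempty with hE | hne
  · refine ⟨0, fun θ h1 h2 => ?_⟩
    have : θ ∈ S := ⟨h1, h2⟩
    rw [hE] at this
    exact this.elim
  · obtain ⟨θ₀, hθ₀, hmax⟩ := hScomp.exists_isMaxOn hne (hcont (L + 1)).continuousOn
    exact ⟨_, fun θ h1 h2 n => natCast_mul_norm_pow_le (Nat.succ_pos L) (norm_nonneg _) (hL hθ₀)
      le_rfl (hmax (show θ ∈ S from ⟨h1, h2⟩)) (h.norm_twist_le_one θ) n⟩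

end IsStochastic

end LinearRepresentation

section LocalLimit

open MeasureTheory

theorem integral_abs_mul_exp_neg_mul_sq {b : ℝ} (hb : 0 < b) :
    ∫ x : ℝ, |x| * Real.exp (-b * x ^ 2) = b⁻¹ := by
  have h1 : ∫ x : ℝ in Set.Ioi 0, x * Real.exp (-b * x ^ 2) = (2 * b)⁻¹ := by
    have h2 := integral_mul_cexp_neg_mul_sq (b := (b : ℂ)) (by simpa using hb)
    have h3 : ∀ r : ℝ, (r : ℂ) * Complex.exp (-b * r ^ 2) =
        ((r * Real.exp (-b * r ^ 2) : ℝ) : ℂ) := fun r => by push_cast; rfl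
    simp only [h3] at h2
    rw [integral_complex_ofReal] at h2
    exact_mod_cast h2
  have h4 := integral_comp_abs (f := fun x => x * Real.exp (-b * x ^ 2))
  simp only [sq_abs] at h4
  rw [h4, h1]
  field_simp

theorem integrable_abs_mul_exp_neg_mul_sq {b : ℝ} (hb : 0 < b) :
    Integrable fun x : ℝ => |x| * Real.exp (-b * x ^ 2) := by
  refine (integrable_mul_exp_neg_mul_sq hb).norm.congr (Filter.Eventually.of_forall fun x => ?_)
  simp

theorem integral_gaussian_character {γ : ℝ} (hγ : 0 < γ) (t : ℝ) {n : ℕ} (hn : 0 < n) :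
    ∫ θ : ℝ, Complex.exp (-(γ * n / 2 : ℝ) * θ ^ 2 + (t * Complex.I) * θ + 0) =
      (√(2 * Real.pi / (γ * n)) * Real.exp (-t ^ 2 / (2 * γ * n)) : ℝ) := by
  have hn' : (0 : ℝ) < n := Nat.cast_pos.2 hn
  have hb : 0 < ((γ * n / 2 : ℝ) : ℂ).re := by
    rw [Complex.ofReal_re]
    positivity
  have h1 := fourierIntegral_gaussian hb (t : ℂ)
  have h2 : ∀ θ : ℝ, Complex.exp (-(γ * n / 2 : ℝ) * θ ^ 2 + (t * Complex.I) * θ + 0) =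
      Complex.exp (Complex.I * t * θ) * Complex.exp (-(γ * n / 2 : ℝ) * θ ^ 2) := fun θ => by
    rw [← Complex.exp_add]
    ring_nf
  simp only [h2]
  rw [h1, Complex.ofReal_mul]
  congr 1
  · rw [Real.sqrt_eq_rpow, Complex.ofReal_cpow (by positivity)]
    push_cast
    congr 1
    have : (n : ℂ) ≠ 0 := by exact_mod_cast hn.ne'
    have : (γ : ℂ) ≠ 0 := by exact_mod_cast hγ.ne'
    field_simp
  · push_cast
    congr 1
    have : (n : ℂ) ≠ 0 := by exact_mod_cast hn.ne'
    have : (γ : ℂ) ≠ 0 := by exact_mod_cast hγ.ne'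
    field_simp
    ring

theorem norm_mul_exp_pow_sub_le {γ C θ : ℝ} (hγ : 0 < γ) (hC : 0 ≤ C) (hθ : C * |θ| ≤ γ / 4)
    {w e s a : ℂ} (hw : w.re = -(γ / 2 * θ ^ 2)) (he : ‖e‖ ≤ C * |θ| ^ 3) (hs : ‖s - a‖ ≤ C * |θ|)
    (n : ℕ) :
    ‖s * Complex.exp (w + e) ^ n - a * Complex.exp w ^ n‖ ≤
      (C + ‖a‖ * C * (8 / γ)) * |θ| * Real.exp (-(γ * n / 8) * θ ^ 2) := by
  have hne : ‖(n : ℂ) * e‖ ≤ n * (C * |θ| ^ 3) := by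
    rw [norm_mul, Complex.norm_natCast]
    exact mul_le_mul_of_nonneg_left he (Nat.cast_nonneg n)
  have hcube : n * (C * |θ| ^ 3) ≤ γ * n / 4 * θ ^ 2 := by
    have h1 : (n : ℝ) * (C * |θ| ^ 3) = (C * |θ|) * (n * θ ^ 2) := by
      rw [← sq_abs θ]
      ring
    rw [h1]
    calc C * |θ| * (n * θ ^ 2) ≤ γ / 4 * (n * θ ^ 2) :=
          mul_le_mul_of_nonneg_right hθ (by positivity)
      _ = _ := by ring
  have hexp1 : ‖Complex.exp (n * e)‖ ≤ Real.exp (γ * n / 4 * θ ^ 2) := by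
    rw [Complex.norm_exp]
    exact Real.exp_le_exp.2 ((Complex.re_le_norm _).trans (hne.trans hcube))
  have hexp2 : ‖Complex.exp (n * e) - 1‖ ≤
      n * (C * |θ| ^ 3) * Real.exp (γ * n / 4 * θ ^ 2) := by
    have h1 := Complex.norm_exp_sub_sum_le_norm_mul_exp (n * e) 1
    simp only [Finset.range_one, Finset.sum_singleton, pow_zero, Nat.factorial_zero,
      Nat.cast_one, div_one, pow_one] at h1
    exact h1.trans (mul_le_mul hne (Real.exp_le_exp.2 (hne.trans hcube)) (Real.exp_pos _).le
      (by positivity))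
  have hw' : ‖Complex.exp (n * w)‖ = Real.exp (-(γ * n / 2 * θ ^ 2)) := by
    rw [Complex.norm_exp, ← Complex.ofReal_natCast, Complex.re_ofReal_mul, hw]
    ring_nf
  have hlin : n * (C * |θ| ^ 3) ≤ C * (8 / γ) * |θ| * Real.exp (γ * n / 8 * θ ^ 2) := by
    have h1 : (n : ℝ) * (C * |θ| ^ 3) = C * (8 / γ) * |θ| * (γ * n / 8 * θ ^ 2) := by
      rw [← sq_abs θ]
      field_simp
    rw [h1]
    refine mul_le_mul_of_nonneg_left ?_ (by positivity)
    linarith [Real.add_one_le_exp (γ * n / 8 * θ ^ 2)]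
  have hsplit : s * Complex.exp (w + e) ^ n - a * Complex.exp w ^ n =
      Complex.exp (n * w) * ((s - a) * Complex.exp (n * e) + a * (Complex.exp (n * e) - 1)) := by
    rw [← Complex.exp_nat_mul, ← Complex.exp_nat_mul, mul_add, Complex.exp_add]
    ring
  have hone : 1 ≤ Real.exp (γ * n / 8 * θ ^ 2) := Real.one_le_exp (by positivity)
  rw [hsplit, norm_mul, hw']
  calc Real.exp (-(γ * n / 2 * θ ^ 2)) *
        ‖(s - a) * Complex.exp (n * e) + a * (Complex.exp (n * e) - 1)‖
      ≤ Real.exp (-(γ * n / 2 * θ ^ 2)) * (C * |θ| * Real.exp (γ * n / 4 * θ ^ 2)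
          + ‖a‖ * (n * (C * |θ| ^ 3) * Real.exp (γ * n / 4 * θ ^ 2))) := by
        refine mul_le_mul_of_nonneg_left ((norm_add_le _ _).trans (add_le_add ?_ ?_))
          (Real.exp_pos _).le
        · rw [norm_mul]
          exact mul_le_mul hs hexp1 (norm_nonneg _) (by positivity)
        · rw [norm_mul]
          exact mul_le_mul_of_nonneg_left hexp2 (norm_nonneg _)
    _ ≤ Real.exp (-(γ * n / 2 * θ ^ 2)) *
          (C * |θ| * Real.exp (γ * n / 8 * θ ^ 2) * Real.exp (γ * n / 4 * θ ^ 2)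
          + ‖a‖ * (C * (8 / γ) * |θ| * Real.exp (γ * n / 8 * θ ^ 2) *
            Real.exp (γ * n / 4 * θ ^ 2))) := by
        refine mul_le_mul_of_nonneg_left (add_le_add ?_ ?_) (Real.exp_pos _).le
        · exact mul_le_mul_of_nonneg_right (le_mul_of_one_le_right (by positivity) hone)
            (Real.exp_pos _).le
        · exact mul_le_mul_of_nonneg_left
            (mul_le_mul_of_nonneg_right hlin (Real.exp_pos _).le) (norm_nonneg _)
    _ = (C + ‖a‖ * C * (8 / γ)) * |θ| * (Real.exp (-(γ * n / 2 * θ ^ 2)) *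
          Real.exp (γ * n / 8 * θ ^ 2) * Real.exp (γ * n / 4 * θ ^ 2)) := by ring
    _ = _ := by
        rw [← Real.exp_add, ← Real.exp_add]
        ring_nf

/-- Fourier inversion of a function that is close to a Gaussian near `0` and small elsewhere. -/
theorem norm_integral_sub_gaussian_le {γ C D δ : ℝ} (β : ℝ) (a : ℂ) (hγ : 0 < γ)
    (hC : 0 ≤ C) (hD : 0 ≤ D) (hδ : 0 < δ) (hδπ : δ ≤ Real.pi)
    (hCδ : C * δ ≤ γ / 4) {n : ℕ} (hn : 0 < n) {f : ℝ → ℂ}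
    (hf : Continuous f)
    (hnear : ∀ θ : ℝ, |θ| ≤ δ → ∃ s e r : ℂ,
      f θ = s * Complex.exp (β * (θ * Complex.I) + γ / 2 * (θ * Complex.I) ^ 2 + e) ^ n + r ∧
        ‖e‖ ≤ C * |θ| ^ 3 ∧ ‖s - a‖ ≤ C * |θ| ∧ n * ‖r‖ ≤ D)
    (hfar : ∀ θ : ℝ, δ ≤ |θ| → |θ| ≤ Real.pi → n * ‖f θ‖ ≤ D) (x : ℝ) :
    ‖(∫ θ in (-Real.pi)..Real.pi, f θ * Complex.exp (-x * (θ * Complex.I))) -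
      a * (√(2 * Real.pi / (γ * n)) * Real.exp (-(x - β * n) ^ 2 / (2 * γ * n)) : ℝ)‖ ≤
      ((C + ‖a‖ * C * (8 / γ) + ‖a‖ / δ) * (8 / γ) + 2 * Real.pi * D) / n := by
  have hn' : (0 : ℝ) < n := Nat.cast_pos.2 hn
  set K := C + ‖a‖ * C * (8 / γ) + ‖a‖ / δ with hK
  set S := Set.Ioc (-Real.pi) Real.pi with hS
  set F : ℝ → ℂ := fun θ => f θ * Complex.exp (-x * (θ * Complex.I)) with hF
  set G : ℝ → ℂ := fun θ => Complex.exp (-(γ * n / 2 : ℝ) * θ ^ 2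
    + ((β * n - x : ℝ) * Complex.I) * θ + 0) with hG
  have hFc : Continuous F := by
    rw [hF]
    fun_prop
  have hFint : Integrable (S.indicator F) := by
    rw [integrable_indicator_iff measurableSet_Ioc]
    exact (hFc.integrableOn_Icc).mono_set Set.Ioc_subset_Icc_self
  have hGint : Integrable fun θ => a * G θ :=
    (integrable_cexp_quadratic (by rw [Complex.ofReal_re]; positivity) _ _).const_mul a
  have hFI : ∫ θ in (-Real.pi)..Real.pi, F θ = ∫ θ, S.indicator F θ := by
    rw [intervalIntegral.integral_of_le (by linarith [Real.pi_pos]),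
      integral_indicator measurableSet_Ioc]
  have hGI : ∫ θ, a * G θ =
      a * (√(2 * Real.pi / (γ * n)) * Real.exp (-(x - β * n) ^ 2 / (2 * γ * n)) : ℝ) := by
    rw [integral_const_mul, hG, integral_gaussian_character hγ _ hn,
      show (β * n - x) ^ 2 = (x - β * n) ^ 2 by ring]
  rw [← hGI, hFI, ← integral_sub hFint hGint]
  have hnormE : ∀ θ : ℝ, ‖Complex.exp (-x * (θ * Complex.I))‖ = 1 := fun θ => by
    rw [← Complex.norm_exp_ofReal_mul_I (-x * θ)]
    push_cast
    ring_nf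
  have hGsplit : ∀ θ : ℝ, G θ =
      Complex.exp (β * (θ * Complex.I) + γ / 2 * (θ * Complex.I) ^ 2) ^ n *
        Complex.exp (-x * (θ * Complex.I)) := fun θ => by
    rw [hG, ← Complex.exp_nat_mul, ← Complex.exp_add]
    rw [mul_pow, Complex.I_sq]
    push_cast
    ring_nf
  have hre : ∀ θ : ℝ, (β * (θ * Complex.I) + γ / 2 * (θ * Complex.I) ^ 2 : ℂ).re =
      -(γ / 2 * θ ^ 2) := fun θ => by
    rw [mul_pow, Complex.I_sq, show (β * (θ * Complex.I) + γ / 2 * (θ ^ 2 * -1) : ℂ) =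
      ((-(γ / 2 * θ ^ 2) : ℝ) : ℂ) + ((β * θ : ℝ) : ℂ) * Complex.I by push_cast; ring]
    simp only [Complex.add_re, Complex.ofReal_re, Complex.re_ofReal_mul, Complex.I_re, mul_zero,
      add_zero]
  have hGfar : ∀ θ : ℝ, δ ≤ |θ| →
      ‖a * G θ‖ ≤ ‖a‖ / δ * (|θ| * Real.exp (-(γ * n / 8) * θ ^ 2)) := fun θ hθ => by
    rw [norm_mul, hGsplit, norm_mul, hnormE, mul_one, norm_pow, Complex.norm_exp, hre,
      ← Real.exp_nat_mul]
    have h1 : Real.exp (n * -(γ / 2 * θ ^ 2)) ≤ Real.exp (-(γ * n / 8) * θ ^ 2) := by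
      apply Real.exp_le_exp.2
      have : 0 ≤ γ * n * θ ^ 2 := by positivity
      linarith
    have h2 : 1 ≤ |θ| / δ := (one_le_div hδ).2 hθ
    calc ‖a‖ * Real.exp (n * -(γ / 2 * θ ^ 2))
        ≤ ‖a‖ * (|θ| / δ * Real.exp (-(γ * n / 8) * θ ^ 2)) := by
          refine mul_le_mul_of_nonneg_left (h1.trans ?_) (norm_nonneg _)
          exact le_mul_of_one_le_left (Real.exp_pos _).le h2
      _ = _ := by ring
  have hb : 0 < γ * n / 8 := by positivity
  have hbound : ∀ θ : ℝ, ‖S.indicator F θ - a * G θ‖ ≤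
      K * (|θ| * Real.exp (-(γ * n / 8) * θ ^ 2)) + S.indicator (fun _ => D / n) θ := by
    intro θ
    have hexp : 0 ≤ |θ| * Real.exp (-(γ * n / 8) * θ ^ 2) := by positivity
    have hind : 0 ≤ S.indicator (fun _ : ℝ => D / n) θ :=
      Set.indicator_nonneg (fun _ _ => by positivity) θ
    have hK1 : ‖a‖ / δ ≤ K := by
      rw [hK]
      have : 0 ≤ C + ‖a‖ * C * (8 / γ) := by positivity
      linarith
    have hK2 : C + ‖a‖ * C * (8 / γ) ≤ K := by
      rw [hK]
      have : 0 ≤ ‖a‖ / δ := by positivity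
      linarith
    by_cases hθS : θ ∈ S
    · have hθπ : |θ| ≤ Real.pi := abs_le.2 ⟨hθS.1.le, hθS.2⟩
      rw [Set.indicator_of_mem hθS, Set.indicator_of_mem hθS]
      rcases le_total |θ| δ with hθ | hθ
      · obtain ⟨s, e, r, h1, h2, h3, h4⟩ := hnear θ hθ
        have h5 := norm_mul_exp_pow_sub_le hγ hC
          ((mul_le_mul_of_nonneg_left hθ hC).trans hCδ) (hre θ) h2 h3 n
        have h6 : F θ - a * G θ = ((s * Complex.exp (β * (θ * Complex.I)
            + γ / 2 * (θ * Complex.I) ^ 2 + e) ^ n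
            - a * Complex.exp (β * (θ * Complex.I) + γ / 2 * (θ * Complex.I) ^ 2) ^ n) + r) *
            Complex.exp (-x * (θ * Complex.I)) := by
          change f θ * _ - _ = _
          rw [hGsplit, h1]
          ring
        rw [h6, norm_mul, hnormE, mul_one]
        refine (norm_add_le _ _).trans (add_le_add (h5.trans ?_) ?_)
        · rw [mul_assoc]
          exact mul_le_mul_of_nonneg_right hK2 hexp
        · rw [le_div_iff₀ hn', mul_comm]
          exact h4
      · refine (norm_sub_le _ _).trans ((add_comm _ _).le.trans (add_le_add ?_ ?_))
        · exact (hGfar θ hθ).trans (mul_le_mul_of_nonneg_right hK1 hexp)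
        · rw [hF, norm_mul, hnormE, mul_one, le_div_iff₀ hn', mul_comm]
          exact hfar θ hθ hθπ
    · have hθ : δ ≤ |θ| := by
        refine hδπ.trans ?_
        by_contra hlt
        rw [not_le, abs_lt] at hlt
        exact hθS ⟨hlt.1, hlt.2.le⟩
      rw [Set.indicator_of_notMem hθS, zero_sub, norm_neg]
      exact ((hGfar θ hθ).trans (mul_le_mul_of_nonneg_right hK1 hexp)).trans
        (le_add_of_nonneg_right hind)
  have hint1 := (integrable_abs_mul_exp_neg_mul_sq hb).const_mul K
  have hint2 : Integrable (S.indicator fun _ : ℝ => D / n) := by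
    rw [integrable_indicator_iff measurableSet_Ioc]
    exact (continuous_const.integrableOn_Icc).mono_set Set.Ioc_subset_Icc_self
  refine (norm_integral_le_of_norm_le (hint1.add hint2)
    (Filter.Eventually.of_forall hbound)).trans (le_of_eq ?_)
  simp only [Pi.add_apply]
  rw [integral_add hint1 hint2, integral_const_mul, integral_abs_mul_exp_neg_mul_sq hb,
    integral_indicator measurableSet_Ioc, setIntegral_const, Real.volume_real_Ioc_of_le
      (by linarith [Real.pi_pos]), smul_eq_mul]
  field_simp
  ring

end LocalLimit

theorem integral_exp_intCast_mul_I (m : ℤ) :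
    ∫ θ in (-Real.pi)..Real.pi, Complex.exp (m * (θ * Complex.I)) =
      if m = 0 then (2 * Real.pi : ℂ) else 0 := by
  split_ifs with hm
  · subst hm
    simp only [Int.cast_zero, zero_mul, Complex.exp_zero, intervalIntegral.integral_const]
    rw [Complex.real_smul, mul_one]
    push_cast
    ring
  · have hc : (m : ℂ) * Complex.I ≠ 0 := mul_ne_zero (by exact_mod_cast hm) Complex.I_ne_zero
    have h1 : ∀ θ : ℝ, (m : ℂ) * (θ * Complex.I) = m * Complex.I * θ := fun θ => by ring
    simp only [h1]
    rw [integral_exp_mul_complex hc, div_eq_zero_iff]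
    left
    rw [sub_eq_zero, Complex.exp_eq_exp_iff_exists_int]
    refine ⟨m, ?_⟩
    push_cast
    ring

namespace LinearRepresentation

variable {ι : Type*} [Fintype ι] [DecidableEq ι]

/-- The total weight of the words of length `n` with `k` occurrences of `a`. -/
noncomputable def weight (R : LinearRepresentation ι) (n k : ℕ) : ℝ :=
  ∑ w : Fin n → Letter with (List.ofFn w).count Letter.a = k, R.series (List.ofFn w)

/-- The total weight of the words of length `n`. -/
noncomputable def totalWeight (R : LinearRepresentation ι) (n : ℕ) : ℝ :=
  ∑ w : Fin n → Letter, R.series (List.ofFn w)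

/-- The form `ξ' X η`. -/
noncomputable def form (R : LinearRepresentation ι) (X : Matrix ι ι ℂ) : ℂ :=
  ∑ i, ∑ j, (R.ξ i : ℂ) * X i j * R.η j

theorem form_sub (R : LinearRepresentation ι) (X Y : Matrix ι ι ℂ) :
    R.form (X - Y) = R.form X - R.form Y := by
  simp [form, mul_sub, sub_mul, Finset.sum_sub_distrib]

theorem form_smul (R : LinearRepresentation ι) (c : ℂ) (X : Matrix ι ι ℂ) :
    R.form (c • X) = c * R.form X := by
  simp only [form, Matrix.smul_apply, smul_eq_mul, Finset.mul_sum]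
  exact Finset.sum_congr rfl fun i _ => Finset.sum_congr rfl fun j _ => by ring

theorem form_sum {κ : Type*} (R : LinearRepresentation ι) (s : Finset κ)
    (X : κ → Matrix ι ι ℂ) : R.form (∑ k ∈ s, X k) = ∑ k ∈ s, R.form (X k) := by
  simp only [form, Matrix.sum_apply, Finset.mul_sum, Finset.sum_mul]
  exact (Finset.sum_congr rfl fun i _ => Finset.sum_comm).trans Finset.sum_comm

theorem form_map_μ (R : LinearRepresentation ι) (w : List Letter) :
    R.form ((R.μ w).map ((↑) : ℝ → ℂ)) = R.series w := by
  simp [form, series, dotProduct, Matrix.mulVec, Finset.mul_sum, mul_assoc]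

theorem form_twist_pow (R : LinearRepresentation ι) (z : ℂ) (n : ℕ) :
    R.form (R.twist z ^ n) = ∑ w : Fin n → Letter,
      (R.series (List.ofFn w) : ℂ) * Complex.exp (z * ((List.ofFn w).count Letter.a : ℕ)) := by
  rw [twist_pow_eq_sum, form_sum]
  exact Finset.sum_congr rfl fun w _ => by rw [form_smul, form_map_μ, mul_comm]

theorem form_twist_zero_pow (R : LinearRepresentation ι) (n : ℕ) :
    R.form (R.twist 0 ^ n) = R.totalWeight n := by
  rw [form_twist_pow, totalWeight]
  simp

open scoped Matrix.Norms.Operator in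
theorem norm_form_le (R : LinearRepresentation ι) (X : Matrix ι ι ℂ) :
    ‖R.form X‖ ≤ (∑ i, ∑ j, R.ξ i * R.η j) * ‖X‖ := by
  rw [form, Finset.sum_mul]
  refine (norm_sum_le _ _).trans (Finset.sum_le_sum fun i _ => ?_)
  rw [Finset.sum_mul]
  refine (norm_sum_le _ _).trans (Finset.sum_le_sum fun j _ => ?_)
  have h1 : ‖X i j‖ ≤ ‖X‖ :=
    (Finset.single_le_sum (fun k _ => norm_nonneg (X i k)) (Finset.mem_univ j)).trans
      ((Matrix.linfty_opNorm_le_iff (norm_nonneg X)).1 le_rfl i)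
  rw [norm_mul, norm_mul, Complex.norm_real, Complex.norm_real,
    Real.norm_of_nonneg (R.ξ_nonneg i), Real.norm_of_nonneg (R.η_nonneg j), mul_right_comm]
  exact mul_le_mul_of_nonneg_left h1 (mul_nonneg (R.ξ_nonneg i) (R.η_nonneg j))

theorem continuous_form_twist_pow (R : LinearRepresentation ι) (n : ℕ) :
    Continuous fun θ : ℝ => R.form (R.twist (θ * Complex.I) ^ n) := by
  simp only [form_twist_pow]
  fun_prop

/-- Fourier inversion for the weights. -/
theorem integral_form_twist_pow (R : LinearRepresentation ι) (n k : ℕ) :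
    ∫ θ in (-Real.pi)..Real.pi,
      R.form (R.twist (θ * Complex.I) ^ n) * Complex.exp (-(k : ℝ) * (θ * Complex.I)) =
      2 * Real.pi * R.weight n k := by
  have h1 : ∀ θ : ℝ, R.form (R.twist (θ * Complex.I) ^ n) *
      Complex.exp (-(k : ℝ) * (θ * Complex.I)) = ∑ w : Fin n → Letter,
        (R.series (List.ofFn w) : ℂ) *
          Complex.exp ((((List.ofFn w).count Letter.a : ℤ) - k : ℤ) * (θ * Complex.I)) :=
    fun θ => by
      rw [form_twist_pow, Finset.sum_mul]
      refine Finset.sum_congr rfl fun w _ => ?_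
      rw [mul_assoc, ← Complex.exp_add]
      push_cast
      ring_nf
  simp only [h1]
  rw [intervalIntegral.integral_finsetSum fun w _ =>
    Continuous.intervalIntegrable (by fun_prop) _ _]
  simp only [intervalIntegral.integral_const_mul, integral_exp_intCast_mul_I]
  rw [weight, Finset.sum_filter, Complex.ofReal_sum, Finset.mul_sum]
  refine Finset.sum_congr rfl fun w _ => ?_
  have h2 : ((List.ofFn w).count Letter.a : ℤ) - k = 0 ↔ (List.ofFn w).count Letter.a = k := by
    omega
  simp only [h2]
  split_ifs <;> simp [mul_comm]

namespace IsStochastic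

variable {R : LinearRepresentation ι} {p : ι → ℝ}

theorem form_stationaryMatrix :
    R.form (stationaryMatrix p) = (((∑ i, R.ξ i) * ∑ j, p j * R.η j : ℝ) : ℂ) := by
  simp [form, stationaryMatrix, Finset.sum_mul_sum, mul_assoc]

open scoped Matrix.Norms.Operator in
/-- The local limit theorem for a primitive aperiodic stochastic representation. -/
theorem local_limit (h : R.IsStochastic p) (hap : R.IsAperiodicPair) {U : ℂ → ℂ}
    (hU : R.IsBranch U) :
    ∃ β γ : ℝ, 0 < γ ∧ deriv U 0 = β ∧ deriv (deriv U) 0 = ((γ + β ^ 2 : ℝ) : ℂ) ∧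
      ∃ C : ℝ, ∀ n : ℕ, 0 < n →
        |R.totalWeight n - (∑ i, R.ξ i) * ∑ j, p j * R.η j| ≤ C / n ∧
        ∀ k : ℕ, |R.weight n k - ((∑ i, R.ξ i) * ∑ j, p j * R.η j) *
          (Real.exp (-((k - β * n) ^ 2) / (2 * γ * n)) / √(2 * Real.pi * γ * n))| ≤ C / n := by
  obtain ⟨β, γ, hγ, hβ, hδ⟩ := h.variance_pos hap hU
  refine ⟨β, γ, hγ, hβ, hδ, ?_⟩
  set a : ℝ := (∑ i, R.ξ i) * ∑ j, p j * R.η j with ha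
  set D : ℝ := ∑ i, ∑ j, R.ξ i * R.η j with hD
  have hD0 : 0 ≤ D := Finset.sum_nonneg fun i _ => Finset.sum_nonneg fun j _ =>
    mul_nonneg (R.ξ_nonneg i) (R.η_nonneg j)
  obtain ⟨Q, hQ, hQ0, C₁, hC₁⟩ := h.exists_spectral_projection hU
  have hC₁0 : R.form (Q 0) = a := by rw [hQ0, form_stationaryMatrix]
  obtain ⟨C₂, hC₂⟩ := exists_log_expansion hU.analyticAt hU.apply_zero hβ (c := γ)
    (by rw [hδ]; push_cast; rfl)
  have hsa : AnalyticAt ℂ (fun z => R.form (Q z)) 0 :=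
    Finset.analyticAt_fun_sum _ fun i _ => Finset.analyticAt_fun_sum _ fun j _ =>
      (analyticAt_const.mul (hQ i j)).mul analyticAt_const
  obtain ⟨C₃, hC₃⟩ := (hsa.differentiableAt.hasDerivAt.isBigO_sub).bound
  obtain ⟨ε, hε, hball⟩ := Metric.eventually_nhds_iff.1 (hC₁.and (hC₂.and hC₃))
  obtain ⟨C, hC0, hDC₁, hC₂C, hC₃C⟩ :
      ∃ C : ℝ, 0 < C ∧ D * C₁ ≤ C ∧ C₂ ≤ C ∧ C₃ ≤ C :=
    ⟨max (max (D * C₁) C₂) (max C₃ 1), by positivity, by simp, by simp, by simp⟩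
  set δ := min (min (ε / 2) Real.pi) (γ / 4 / C) with hδdef
  have hδ0 : 0 < δ := by
    have := Real.pi_pos
    positivity
  obtain ⟨C₄, hC₄⟩ := h.exists_decay hap hδ0
  obtain ⟨B, hB0, hCB, hDB⟩ : ∃ B : ℝ, 0 ≤ B ∧ C ≤ B ∧ D * C₄ ≤ B :=
    ⟨max C (D * C₄), hC0.le.trans (le_max_left _ _), le_max_left _ _, le_max_right _ _⟩
  have hnorm : ∀ (n : ℕ) (X : Matrix ι ι ℂ) (c : ℝ), n * ‖X‖ ≤ c → n * ‖R.form X‖ ≤ D * c :=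
    fun n X c hX => by
      calc n * ‖R.form X‖ ≤ n * (D * ‖X‖) :=
            mul_le_mul_of_nonneg_left (R.norm_form_le X) (Nat.cast_nonneg n)
        _ = D * (n * ‖X‖) := by ring
        _ ≤ D * c := mul_le_mul_of_nonneg_left hX hD0
  have hnormI : ∀ θ : ℝ, ‖(θ : ℂ) * Complex.I‖ = |θ| := fun θ => by simp
  have hnear : ∀ n : ℕ, 0 < n → ∀ θ : ℝ, |θ| ≤ δ → ∃ s e r : ℂ,
      R.form (R.twist (θ * Complex.I) ^ n) =
        s * Complex.exp (β * (θ * Complex.I) + γ / 2 * (θ * Complex.I) ^ 2 + e) ^ n + r ∧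
        ‖e‖ ≤ C * |θ| ^ 3 ∧ ‖s - (a : ℂ)‖ ≤ C * |θ| ∧ n * ‖r‖ ≤ B := by
    intro n hn θ hθ
    have hθε : dist ((θ : ℂ) * Complex.I) 0 < ε := by
      rw [dist_zero_right, hnormI]
      have h1 : δ ≤ ε / 2 := (min_le_left _ _).trans (min_le_left _ _)
      linarith
    obtain ⟨h1, ⟨e, he, hUe⟩, h3⟩ := hball hθε
    rw [hC₁0, sub_zero, hnormI] at h3
    rw [hnormI] at he
    refine ⟨R.form (Q (θ * Complex.I)), e, R.form (R.twist (θ * Complex.I) ^ n -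
      U (θ * Complex.I) ^ n • Q (θ * Complex.I)), ?_, ?_, ?_, ?_⟩
    · rw [form_sub, form_smul, ← hUe]
      ring
    · exact he.trans (mul_le_mul_of_nonneg_right hC₂C (by positivity))
    · exact h3.trans (mul_le_mul_of_nonneg_right hC₃C (abs_nonneg _))
    · exact (hnorm n _ _ (h1 n hn)).trans (hDC₁.trans hCB)
  have hfar : ∀ n : ℕ, ∀ θ : ℝ, δ ≤ |θ| → |θ| ≤ Real.pi →
      n * ‖R.form (R.twist (θ * Complex.I) ^ n)‖ ≤ B := fun n θ h1 h2 =>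
    (hnorm n _ _ (hC₄ θ h1 h2 n)).trans hDB
  have hCδ : C * δ ≤ γ / 4 := by
    calc C * δ ≤ C * (γ / 4 / C) := mul_le_mul_of_nonneg_left (min_le_right _ _) hC0.le
      _ = γ / 4 := by field_simp
  have hδπ : δ ≤ Real.pi := (min_le_left _ _).trans (min_le_right _ _)
  set E := (C + ‖(a : ℂ)‖ * C * (8 / γ) + ‖(a : ℂ)‖ / δ) * (8 / γ) + 2 * Real.pi * B with hE
  have hE0 : 0 ≤ E := by positivity
  refine ⟨max B (E / (2 * Real.pi)), fun n hn => ⟨?_, fun k => ?_⟩⟩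
  · have hn' : (0 : ℝ) < n := Nat.cast_pos.2 hn
    have h1 := hnorm n _ _ (hC₁.self_of_nhds n hn)
    rw [hU.apply_zero, one_pow, one_smul, form_sub, form_twist_zero_pow, hC₁0,
      ← Complex.ofReal_sub, Complex.norm_real, Real.norm_eq_abs] at h1
    refine le_trans ?_ (div_le_div_of_nonneg_right (le_max_left _ _) hn'.le)
    rw [le_div_iff₀ hn', mul_comm]
    exact h1.trans (hDC₁.trans hCB)
  · have hn' : (0 : ℝ) < n := Nat.cast_pos.2 hn
    have h1 := norm_integral_sub_gaussian_le β a hγ hC0.le hB0 hδ0 hδπ hCδ hn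
      (R.continuous_form_twist_pow n) (hnear n hn) (hfar n) k
    rw [← hE, integral_form_twist_pow] at h1
    have hsqrt : √(2 * Real.pi / (γ * n)) = 2 * Real.pi / √(2 * Real.pi * γ * n) := by
      rw [eq_div_iff (by positivity), ← Real.sqrt_mul (by positivity),
        show 2 * Real.pi / (γ * n) * (2 * Real.pi * γ * n) = (2 * Real.pi) ^ 2 by field_simp,
        Real.sqrt_sq (by positivity)]
    have h2 : (2 * Real.pi * R.weight n k - a * (√(2 * Real.pi / (γ * n)) *
        Real.exp (-((k : ℝ) - β * n) ^ 2 / (2 * γ * n)) : ℝ) : ℂ) =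
        ((2 * Real.pi * (R.weight n k - a * (Real.exp (-((k - β * n) ^ 2) / (2 * γ * n)) /
          √(2 * Real.pi * γ * n))) : ℝ) : ℂ) := by
      rw [hsqrt]
      push_cast
      ring
    rw [h2, Complex.norm_real, Real.norm_eq_abs, abs_mul, abs_of_pos Real.two_pi_pos] at h1
    refine le_trans ?_ (div_le_div_of_nonneg_right (le_max_right _ _) hn'.le)
    rw [div_right_comm, le_div_iff₀ Real.two_pi_pos, mul_comm]
    exact h1

end IsStochastic

end LinearRepresentation

namespace LinearRepresentation

variable {ι : Type*}

/-- The representation rescaled by `r` and conjugated by the diagonal matrix of `x`. -/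
noncomputable def rescale (R : LinearRepresentation ι) {r : ℝ} (hr : 0 < r) {x : ι → ℝ}
    (hx : ∀ i, 0 < x i) : LinearRepresentation ι where
  ξ i := R.ξ i * x i
  A := Matrix.of fun i j => r⁻¹ * ((x i)⁻¹ * R.A i j * x j)
  B := Matrix.of fun i j => r⁻¹ * ((x i)⁻¹ * R.B i j * x j)
  η i := (x i)⁻¹ * R.η i
  ξ_nonneg i := mul_nonneg (R.ξ_nonneg i) (hx i).le
  A_nonneg i j := mul_nonneg (inv_pos.2 hr).le (mul_nonneg
    (mul_nonneg (inv_pos.2 (hx i)).le (R.A_nonneg i j)) (hx j).le)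
  B_nonneg i j := mul_nonneg (inv_pos.2 hr).le (mul_nonneg
    (mul_nonneg (inv_pos.2 (hx i)).le (R.B_nonneg i j)) (hx j).le)
  η_nonneg i := mul_nonneg (inv_pos.2 (hx i)).le (R.η_nonneg i)

section Rescale

variable (R : LinearRepresentation ι) {r : ℝ} (hr : 0 < r) {x : ι → ℝ} (hx : ∀ i, 0 < x i)

theorem rescale_letterMatrix (l : Letter) (i j : ι) :
    (R.rescale hr hx).letterMatrix l i j = r⁻¹ * ((x i)⁻¹ * R.letterMatrix l i j * x j) := by
  cases l <;> rfl

theorem rescale_M (i j : ι) :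
    (R.rescale hr hx).M i j = r⁻¹ * ((x i)⁻¹ * R.M i j * x j) := by
  simp only [M, rescale, Matrix.add_apply, Matrix.of_apply]
  ring

theorem rescale_isWalk_iff {i j : ι} {w : List Letter} :
    (R.rescale hr hx).IsWalk i w j ↔ R.IsWalk i w j := by
  have hpos : ∀ (l : Letter) (i j : ι),
      0 < (R.rescale hr hx).letterMatrix l i j ↔ 0 < R.letterMatrix l i j := fun l i j => by
    rw [rescale_letterMatrix, mul_pos_iff_of_pos_left (inv_pos.2 hr),
      mul_pos_iff_of_pos_right (hx j), mul_pos_iff_of_pos_left (inv_pos.2 (hx i))]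
  constructor
  · intro h
    induction h with
    | nil i => exact IsWalk.nil i
    | cons hl _ ih => exact IsWalk.cons ((hpos _ _ _).1 hl) ih
  · intro h
    induction h with
    | nil i => exact IsWalk.nil i
    | cons hl _ ih => exact IsWalk.cons ((hpos _ _ _).2 hl) ih

theorem rescale_isAperiodicPair_iff :
    (R.rescale hr hx).IsAperiodicPair ↔ R.IsAperiodicPair := by
  simp only [IsAperiodicPair, period, IsCycleLabel, rescale_isWalk_iff]

variable [Fintype ι] [DecidableEq ι]

theorem rescale_μ (w : List Letter) (i j : ι) :
    (R.rescale hr hx).μ w i j = r⁻¹ ^ w.length * ((x i)⁻¹ * R.μ w i j * x j) := by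
  induction w generalizing i with
  | nil =>
    rw [μ_nil, μ_nil, Matrix.one_apply]
    split_ifs with hij
    · subst hij
      have := (hx i).ne'
      simp [this]
    · simp
  | cons l w ih =>
    simp only [μ_cons, Matrix.mul_apply, rescale_letterMatrix, ih, List.length_cons,
      Finset.mul_sum, Finset.sum_mul]
    refine Finset.sum_congr rfl fun k _ => ?_
    have := (hx k).ne'
    rw [pow_succ]
    field_simp

theorem rescale_series (w : List Letter) :
    (R.rescale hr hx).series w = r⁻¹ ^ w.length * R.series w := by
  simp only [series, dotProduct, Matrix.mulVec, rescale_μ, Finset.mul_sum]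
  refine Finset.sum_congr rfl fun i _ => Finset.sum_congr rfl fun j _ => ?_
  have h1 := (hx i).ne'
  have h2 := (hx j).ne'
  simp only [rescale]
  field_simp

theorem rescale_weight (n k : ℕ) :
    (R.rescale hr hx).weight n k = R.weight n k / r ^ n := by
  simp only [weight, rescale_series, List.length_ofFn, ← Finset.mul_sum]
  rw [inv_pow, div_eq_inv_mul]

theorem rescale_totalWeight (n : ℕ) :
    (R.rescale hr hx).totalWeight n = R.totalWeight n / r ^ n := by
  simp only [totalWeight, rescale_series, List.length_ofFn, ← Finset.mul_sum]
  rw [inv_pow, div_eq_inv_mul]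

theorem rescale_M_pow (n : ℕ) (i j : ι) :
    ((R.rescale hr hx).M ^ n) i j = r⁻¹ ^ n * ((x i)⁻¹ * (R.M ^ n) i j * x j) := by
  simp only [M_pow_eq_sum, Matrix.sum_apply, rescale_μ, List.length_ofFn, Finset.mul_sum,
    Finset.sum_mul]

theorem rescale_isStochastic (hR : R.M.IsPrimitive) {z : ι → ℝ} (hz : ∀ i, 0 < z i)
    (hMx : R.M *ᵥ x = r • x) (hMz : z ᵥ* R.M = r • z) (hzx : z ⬝ᵥ x = 1) :
    (R.rescale hr hx).IsStochastic fun i => z i * x i := by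
  refine ⟨⟨fun i j => add_nonneg ((R.rescale hr hx).A_nonneg i j)
    ((R.rescale hr hx).B_nonneg i j), ?_⟩, ?_, fun i => mul_pos (hz i) (hx i), ?_, hzx⟩
  · obtain ⟨k, hk, hpos⟩ := hR.exists_pos_pow
    refine ⟨k, hk, fun i j => ?_⟩
    rw [rescale_M_pow]
    have h1 := hpos i j
    have h2 := hx i
    have h3 := hx j
    positivity
  · ext i
    have h1 := congrFun hMx i
    have h2 := (hx i).ne'
    simp only [Matrix.mulVec, dotProduct, Pi.smul_apply, smul_eq_mul] at h1
    simp only [Matrix.mulVec, dotProduct, rescale_M, Pi.one_apply, mul_one, mul_assoc,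
      ← Finset.mul_sum, h1]
    field_simp
  · ext j
    have h1 := congrFun hMz j
    simp only [Matrix.vecMul, dotProduct, Pi.smul_apply, smul_eq_mul] at h1
    have h2 : ∀ i, z i * x i * (R.rescale hr hx).M i j = r⁻¹ * x j * (z i * R.M i j) := fun i => by
      have h3 := (hx i).ne'
      rw [rescale_M]
      field_simp
    simp only [Matrix.vecMul, dotProduct, h2, ← Finset.mul_sum, h1]
    field_simp

theorem rescale_det_eq_zero_iff (c z : ℂ) :
    (c • (1 : Matrix ι ι ℂ) - (R.rescale hr hx).twist z).det = 0 ↔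
      ((r * c) • (1 : Matrix ι ι ℂ) - Complex.exp z • R.A.map ((↑) : ℝ → ℂ)
        - R.B.map ((↑) : ℝ → ℂ)).det = 0 := by
  have hr' : (r : ℂ) ≠ 0 := by exact_mod_cast hr.ne'
  have hx' : ∀ i, (x i : ℂ) ≠ 0 := fun i => by exact_mod_cast (hx i).ne'
  have h1 : (r * c) • (1 : Matrix ι ι ℂ) - Complex.exp z • R.A.map ((↑) : ℝ → ℂ)
      - R.B.map ((↑) : ℝ → ℂ) = (r : ℂ) • (Matrix.diagonal (fun i => (x i : ℂ)) *
        (c • (1 : Matrix ι ι ℂ) - (R.rescale hr hx).twist z) *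
          Matrix.diagonal fun i => (x i : ℂ)⁻¹) := by
    ext i j
    have hi := hx' i
    have hj := hx' j
    simp only [twist, rescale, Matrix.smul_apply, Matrix.mul_diagonal, Matrix.diagonal_mul,
      Matrix.sub_apply, Matrix.add_apply, Matrix.map_apply, Matrix.of_apply, smul_eq_mul,
      Matrix.one_apply]
    push_cast
    by_cases hij : i = j
    · subst hij
      simp only [if_true]
      field_simp
      ring
    · simp only [if_neg hij]
      field_simp
      ring
  have h2 : ∏ i, (x i : ℂ) ≠ 0 := Finset.prod_ne_zero_iff.2 fun i _ => hx' i
  rw [h1, Matrix.det_smul, Matrix.det_mul, Matrix.det_mul, Matrix.det_diagonal,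
    Matrix.det_diagonal]
  simp [hr', h2]

end Rescale

variable [Fintype ι] [DecidableEq ι]

theorem α_pos [Nonempty ι] (R : LinearRepresentation ι) (hR : R.M.IsPrimitive)
    (hξ : R.ξ ≠ 0) (hη : R.η ≠ 0) : 0 < R.α := by
  have hp := R.isPerronPair_perronPair hR
  obtain ⟨i, hi⟩ := Function.ne_iff.1 hξ
  obtain ⟨j, hj⟩ := Function.ne_iff.1 hη
  refine mul_pos (Finset.sum_pos' (fun k _ => mul_nonneg (R.ξ_nonneg k) (hp.right_pos k).le)
    ⟨i, Finset.mem_univ _, mul_pos (lt_of_le_of_ne (R.ξ_nonneg i) (Ne.symm hi))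
      (hp.right_pos i)⟩) (Finset.sum_pos' (fun k _ => mul_nonneg (hp.left_pos k).le (R.η_nonneg k))
    ⟨j, Finset.mem_univ _, mul_pos (hp.left_pos j) (lt_of_le_of_ne (R.η_nonneg j) (Ne.symm hj))⟩)

/-- The local limit theorem for the weights of a primitive aperiodic representation. -/
theorem local_limit [Nonempty ι] (R : LinearRepresentation ι) (hR : R.M.IsPrimitive)
    (hap : R.IsAperiodicPair) :
    0 < R.γ ∧ ∃ C : ℝ, ∀ n : ℕ, 0 < n →
      |R.totalWeight n / R.perronRoot ^ n - R.α| ≤ C / n ∧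
      ∀ k : ℕ, |R.weight n k / R.perronRoot ^ n - R.α *
        (Real.exp (-((k - R.β * n) ^ 2) / (2 * R.γ * n)) / √(2 * Real.pi * R.γ * n))| ≤ C / n := by
  have hr := R.perronRoot_pos hR
  have hp := R.isPerronPair_perronPair hR
  set r := R.perronRoot with hrdef
  have hr' : (r : ℂ) ≠ 0 := by exact_mod_cast hr.ne'
  set N := R.rescale hr hp.right_pos with hN
  have hst : N.IsStochastic fun i => R.perronPair.1 i * R.perronPair.2 i :=
    R.rescale_isStochastic hr hp.right_pos hR hp.left_pos hp.right_eigen hp.left_eigen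
      hp.normalized
  have hu : R.IsMainBranch R.u := by
    obtain ⟨U, hU⟩ := hst.exists_isBranch
    refine Classical.epsilon_spec (p := R.IsMainBranch) ⟨fun z => r * U z,
      analyticAt_const.mul hU.analyticAt, by rw [hU.apply_zero, mul_one], ?_⟩
    filter_upwards [hU.det_eq_zero] with z hz
    exact (R.rescale_det_eq_zero_iff hr hp.right_pos _ _).1 hz
  have hU : N.IsBranch fun z => (r : ℂ)⁻¹ * R.u z := by
    refine ⟨analyticAt_const.mul hu.analyticAt, by rw [hu.apply_zero, inv_mul_cancel₀ hr'], ?_⟩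
    filter_upwards [hu.det_eq_zero] with z hz
    rw [hN, rescale_det_eq_zero_iff, mul_inv_cancel_left₀ hr']
    exact hz
  obtain ⟨β, γ, hγ, hβ, hδ, C, hC⟩ :=
    hst.local_limit ((R.rescale_isAperiodicPair_iff hr hp.right_pos).2 hap) hU
  have hd1 : deriv (fun z => (r : ℂ)⁻¹ * R.u z) = fun z => (r : ℂ)⁻¹ * deriv R.u z :=
    funext fun z => deriv_const_mul_field _
  have hre : ∀ (c : ℂ) (b : ℝ), (r : ℂ)⁻¹ * c = b → c.re / r = b := fun c b h => by
    have h1 := congrArg Complex.re h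
    rw [← Complex.ofReal_inv, Complex.re_ofReal_mul, Complex.ofReal_re] at h1
    rw [← h1, div_eq_inv_mul]
  have hβR : R.β = β := by
    rw [hd1] at hβ
    exact hre _ _ hβ
  have hγR : R.γ = γ := by
    rw [hd1, deriv_const_mul_field] at hδ
    have h1 := hre _ _ hδ
    have h2 : R.γ = (deriv (deriv R.u) 0).re / r - R.β ^ 2 := by
      rw [LinearRepresentation.γ, LinearRepresentation.β, iteratedDeriv_succ, iteratedDeriv_one]
    rw [h2, h1, hβR]
    ring
  have hαR : (∑ i, N.ξ i) * ∑ j, R.perronPair.1 j * R.perronPair.2 j * N.η j = R.α := by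
    rw [α, dotProduct, dotProduct]
    congr 1
    refine Finset.sum_congr rfl fun j _ => ?_
    have h1 := (hp.right_pos j).ne'
    simp only [hN, rescale, ζ]
    field_simp
  rw [hβR, hγR]
  refine ⟨hγ, C, fun n hn => ?_⟩
  have h1 := hC n hn
  rw [hαR, hN, rescale_totalWeight] at h1
  simp only [rescale_weight] at h1
  exact h1

section DirectSum

variable {ι₁ ι₂ : Type*} [Fintype ι₁] [DecidableEq ι₁] [Fintype ι₂] [DecidableEq ι₂]
  (R₁ : LinearRepresentation ι₁) (R₂ : LinearRepresentation ι₂)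

theorem directSum_μ (w : List Letter) :
    (R₁.directSum R₂).μ w = Matrix.fromBlocks (R₁.μ w) 0 0 (R₂.μ w) := by
  induction w with
  | nil => rw [μ_nil, μ_nil, μ_nil, Matrix.fromBlocks_one]
  | cons l w ih =>
    have h1 : (R₁.directSum R₂).letterMatrix l =
        Matrix.fromBlocks (R₁.letterMatrix l) 0 0 (R₂.letterMatrix l) := by
      cases l <;> rfl
    rw [μ_cons, μ_cons, μ_cons, ih, h1, Matrix.fromBlocks_multiply]
    simp

theorem directSum_series (w : List Letter) :
    (R₁.directSum R₂).series w = R₁.series w + R₂.series w := by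
  rw [series, directSum_μ]
  simp [series, directSum, Matrix.fromBlocks_mulVec, Function.comp_def, dotProduct]

theorem directSum_probY (n k : ℕ) :
    (R₁.directSum R₂).probY n k =
      (R₁.weight n k + R₂.weight n k) / (R₁.totalWeight n + R₂.totalWeight n) := by
  simp only [probY, wordProb, ← Finset.sum_div, directSum_series, Finset.sum_add_distrib, weight,
    totalWeight]

end DirectSum

end LinearRepresentation

theorem abs_div_sub_div_le {W G t a D E s : ℝ} (ha : 0 < a) (ht : a / 2 ≤ t) (hs : 0 ≤ s)
    (hE : 0 ≤ E) (hG : |G| ≤ D) (hW : |W - G| ≤ E * s) (hta : |t - a| ≤ E * s) :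
    |W / t - G / a| ≤ (2 / a * E + D * (2 / a ^ 2) * E) * s := by
  have ht0 : 0 < t := by linarith
  have h1 : W / t - G / a = (W - G) * t⁻¹ + G * (t⁻¹ * a⁻¹) * (a - t) := by
    field_simp
    ring
  have h2 : t⁻¹ ≤ 2 / a := by
    rw [inv_le_comm₀ ht0 (by positivity), inv_div]
    exact ht
  have h3 : t⁻¹ * a⁻¹ ≤ 2 / a ^ 2 := by
    calc t⁻¹ * a⁻¹ ≤ 2 / a * a⁻¹ := mul_le_mul_of_nonneg_right h2 (by positivity)
      _ = 2 / a ^ 2 := by field_simp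
  have hD : 0 ≤ D := (abs_nonneg G).trans hG
  rw [h1]
  calc |(W - G) * t⁻¹ + G * (t⁻¹ * a⁻¹) * (a - t)|
      ≤ |W - G| * t⁻¹ + |G| * (t⁻¹ * a⁻¹) * |a - t| := by
        refine (abs_add_le _ _).trans (le_of_eq ?_)
        rw [abs_mul, abs_mul, abs_mul, abs_of_pos (inv_pos.2 ht0),
          abs_of_pos (mul_pos (inv_pos.2 ht0) (inv_pos.2 ha))]
    _ ≤ E * s * (2 / a) + D * (2 / a ^ 2) * (E * s) := by
        rw [abs_sub_comm a t]
        gcongr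
    _ = _ := by ring

theorem mainTheorem6 {ι₁ ι₂ : Type*} [Fintype ι₁] [DecidableEq ι₁] [Fintype ι₂] [DecidableEq ι₂]
    (R₁ : LinearRepresentation ι₁) (R₂ : LinearRepresentation ι₂)
    (hmodel : LinearRepresentation.IsEquipotentSumModel R₁ R₂)
    (hap₁ : R₁.IsAperiodicPair) (hap₂ : R₂.IsAperiodicPair) :
    0 < R₁.α ∧ 0 < R₂.α ∧ 0 < R₁.γ ∧ 0 < R₂.γ ∧
    ∃ C : ℝ, ∀ᶠ n : ℕ in Filter.atTop, ∀ k : ℕ, k ≤ n →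
      |√(n : ℝ) * (R₁.directSum R₂).probY n k -
        (R₁.α / (R₁.α + R₂.α) *
            (Real.exp (-(((k : ℝ) - R₁.β * n) ^ 2) / (2 * R₁.γ * n)) / √(2 * Real.pi * R₁.γ)) +
          R₂.α / (R₁.α + R₂.α) *
            (Real.exp (-(((k : ℝ) - R₂.β * n) ^ 2) / (2 * R₂.γ * n)) / √(2 * Real.pi * R₂.γ)))|
        ≤ C * (n : ℝ) ^ (-(1 / 2 : ℝ)) := by
  have : Nonempty ι₁ := ⟨(Function.ne_iff.1 hmodel.ξ₁_ne_zero).choose⟩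
  have : Nonempty ι₂ := ⟨(Function.ne_iff.1 hmodel.ξ₂_ne_zero).choose⟩
  have hα₁ := R₁.α_pos hmodel.primitive₁ hmodel.ξ₁_ne_zero hmodel.η₁_ne_zero
  have hα₂ := R₂.α_pos hmodel.primitive₂ hmodel.ξ₂_ne_zero hmodel.η₂_ne_zero
  obtain ⟨hγ₁, C₁, hC₁⟩ := R₁.local_limit hmodel.primitive₁ hap₁
  obtain ⟨hγ₂, C₂, hC₂⟩ := R₂.local_limit hmodel.primitive₂ hap₂
  refine ⟨hα₁, hα₂, hγ₁, hγ₂, ?_⟩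
  have hr := R₁.perronRoot_pos hmodel.primitive₁
  rw [← hmodel.equipotent] at hC₂
  set r := R₁.perronRoot with hrdef
  set a := R₁.α + R₂.α with ha
  have ha0 : 0 < a := add_pos hα₁ hα₂
  have hC₁0 : 0 ≤ C₁ := by simpa using (abs_nonneg _).trans (hC₁ 1 one_pos).1
  have hC₂0 : 0 ≤ C₂ := by simpa using (abs_nonneg _).trans (hC₂ 1 one_pos).1
  set D := R₁.α * (1 / √(2 * Real.pi * R₁.γ)) + R₂.α * (1 / √(2 * Real.pi * R₂.γ)) with hD
  refine ⟨2 / a * (C₁ + C₂) + D * (2 / a ^ 2) * (C₁ + C₂), ?_⟩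
  filter_upwards [Filter.eventually_gt_atTop 0,
    Filter.eventually_ge_atTop ⌈2 * (C₁ + C₂) / a⌉₊] with n hn hnl k _
  have hn' : (0 : ℝ) < n := Nat.cast_pos.2 hn
  have hsq : √(n : ℝ) * √(n : ℝ) = n := Real.mul_self_sqrt hn'.le
  have hsq0 : 0 < √(n : ℝ) := Real.sqrt_pos.2 hn'
  have hs : (n : ℝ) ^ (-(1 / 2 : ℝ)) = (√(n : ℝ))⁻¹ := by
    rw [Real.rpow_neg hn'.le, Real.sqrt_eq_rpow]
  have hnl' : 2 * (C₁ + C₂) / a ≤ n := (Nat.le_ceil _).trans (by exact_mod_cast hnl)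
  have hrn : 0 < r ^ n := pow_pos hr n
  obtain ⟨hT₁, hW₁⟩ := hC₁ n hn
  obtain ⟨hT₂, hW₂⟩ := hC₂ n hn
  set g₁ := Real.exp (-(((k : ℝ) - R₁.β * n) ^ 2) / (2 * R₁.γ * n)) with hg₁
  set g₂ := Real.exp (-(((k : ℝ) - R₂.β * n) ^ 2) / (2 * R₂.γ * n)) with hg₂
  have hg_le : ∀ {c y : ℝ}, 0 < c → Real.exp (-(y ^ 2) / (2 * c * n)) ≤ 1 := fun {c y} hc =>
    Real.exp_le_one_iff.2 (div_nonpos_of_nonpos_of_nonneg (by nlinarith [sq_nonneg y])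
      (by positivity))
  have hW : ∀ {w b g c B : ℝ}, |w - b * (g / √(2 * Real.pi * c * n))| ≤ B / n →
      |√(n : ℝ) * w - b * (g / √(2 * Real.pi * c))| ≤ B * (√(n : ℝ))⁻¹ := by
    intro w b g c B h
    have h1 : √(n : ℝ) * w - b * (g / √(2 * Real.pi * c)) =
        √(n : ℝ) * (w - b * (g / √(2 * Real.pi * c * n))) := by
      rw [Real.sqrt_mul' _ hn'.le]
      field_simp
    rw [h1, abs_mul, abs_of_pos hsq0]
    calc √(n : ℝ) * |w - b * (g / √(2 * Real.pi * c * n))| ≤ √(n : ℝ) * (B / n) :=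
          mul_le_mul_of_nonneg_left h hsq0.le
      _ = B * (√(n : ℝ))⁻¹ := by
          nth_rewrite 2 [← hsq]
          field_simp
  have hW₁' := hW (hW₁ k)
  have hW₂' := hW (hW₂ k)
  set t := R₁.totalWeight n / r ^ n + R₂.totalWeight n / r ^ n with ht
  have hta : |t - a| ≤ (C₁ + C₂) / n := by
    rw [ht, ha, add_sub_add_comm, add_div]
    exact (abs_add_le _ _).trans (add_le_add hT₁ hT₂)
  have ht2 : a / 2 ≤ t := by
    have h1 : (C₁ + C₂) / n ≤ a / 2 := by
      rw [div_le_iff₀ ha0] at hnl'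
      rw [div_le_iff₀ hn']
      linarith
    have h2 := (abs_le.1 (hta.trans h1)).1
    linarith
  have hta' : |t - a| ≤ (C₁ + C₂) * (√(n : ℝ))⁻¹ := by
    refine hta.trans ?_
    rw [div_eq_mul_inv]
    refine mul_le_mul_of_nonneg_left (inv_anti₀ hsq0 ?_) (by positivity)
    rw [Real.sqrt_le_left hn'.le]
    have h1 : (1 : ℝ) ≤ n := by exact_mod_cast hn
    nlinarith
  set G := R₁.α * (g₁ / √(2 * Real.pi * R₁.γ)) + R₂.α * (g₂ / √(2 * Real.pi * R₂.γ)) with hG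
  have hGD : |G| ≤ D := by
    rw [abs_of_nonneg (by positivity), hG, hD]
    gcongr
    exacts [hg_le hγ₁, hg_le hγ₂]
  set W := √(n : ℝ) * (R₁.weight n k / r ^ n) + √(n : ℝ) * (R₂.weight n k / r ^ n) with hWdef
  have hWG : |W - G| ≤ (C₁ + C₂) * (√(n : ℝ))⁻¹ := by
    rw [hWdef, hG, add_sub_add_comm, add_mul]
    exact (abs_add_le _ _).trans (add_le_add hW₁' hW₂')
  have hfinal := abs_div_sub_div_le ha0 ht2 (inv_pos.2 hsq0).le (by positivity) hGD hWG hta'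
  have hprob : √(n : ℝ) * (R₁.directSum R₂).probY n k = W / t := by
    rw [LinearRepresentation.directSum_probY, hWdef, ht, ← mul_add, ← add_div, ← add_div,
      mul_div_assoc, div_div_div_cancel_right₀ hrn.ne']
  rw [hs, hprob]
  convert hfinal using 2
  rw [hG]
  ring_nf
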